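/- **Model.** An instance consists of an integer $n\ge 1$, the set $V=\{0,\dots,n-1\}$ and a distance matrix $D:\binom V2\to\mathbb{Q}_{\ge 0}$. As usual in the semi-streaming model, each distance is assumed to fit in $O(\log n)$ bits, that is, its numerator and denominator together have at most $c\,(1+\lfloor\log_2 n\rfloor)$ bits (one bit being added for the sign) for a constant $c$. The algorithm knows $n$, and the entries of $D$ arrive one by one, as pairs $(uv,D(uv))$, each unordered pair $uv$ exactly once, in an arbitrary (adversarial) order. A *two-pass streaming algorithm* is a fixed deterministic random access machine program that reads this stream twice from beginning to end. Its *space* is the largest number of bits held in its working memory (contents and addresses of the cells in use, a cell holding a rational number), and its *time* is the number of instructions (arithmetic operations, comparisons, direct and indirect memory accesses) that it executes. It is a *polynomial time semi-streaming algorithm* if, for every constant $c$, on all instances as above it halts within $n^{O(1)}$ instructions and uses $\widetilde O(n)=O(n\log^{O(1)} n)$ bits of space, where the implied constants depend only on $c$. **Problem.** A *tree metric* on $V$ is a function $T:\binom V2\to\mathbb{R}_{\ge0}$ for which there is a finite tree with nonnegative edge lengths whose node set contains $V$ (and possibly further nodes), such that $T(uv)$ is the length of the path between $u$ and $v$ in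 the tree for all $uv\in\binom V2$. In *$\ell_\infty$ Best-Fit Tree-Metrics* one is given $D$ and seeks a tree metric $T$ that minimizes $\|T-D\|_\infty=\max_{uv\in\binom V2}|T(uv)-D(uv)|$. An algorithm *$6$-approximates* it if for every instance $D$ it outputs (as a list of weighted edges) a tree whose tree metric $T$ satisfies $\|T-D\|_\infty\le 6\,\|T'-D\|_\infty$ for every tree metric $T'$ on $V$. **Theorem.** There exists a two-pass polynomial time semi-streaming algorithm that $6$-approximates the $\ell_\infty$ Best-Fit Tree-Metrics problem. -/

import Mathlib

namespace TreeFit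

/-! ### Distance matrices, tree metrics -/

/-- Unordered pairs of distinct elements of `V`. A distance matrix on `V` is a function on
`Pairs V`, and for finite `V` the norm of `Pairs V → ℝ` is the maximum norm. -/
abbrev Pairs (V : Type) : Type := {e : Sym2 V // ¬ e.IsDiag}

/-- The unordered pair `uv`. -/
def mkPair {V : Type} (u v : V) (h : u ≠ v) : Pairs V :=
  ⟨s(u, v), fun hd => h (Sym2.mk_isDiag_iff.mp hd)⟩

/-- A finite tree with nonnegative edge lengths that spans `V`: the elements of `V` are
distinct nodes of the tree, and the tree may have further nodes. -/
structure WeightedTree (V : Type) where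
  order : ℕ
  graph : SimpleGraph (Fin order)
  isTree : graph.IsTree
  weight : Sym2 (Fin order) → ℝ
  weight_nonneg : ∀ e, 0 ≤ weight e
  node : V ↪ Fin order

/-- `d` is the matrix of the distances in `T` between elements of `V`: `d uv` is the length of
the path of `T` that joins `u` and `v`. -/
def WeightedTree.Induces {V : Type} (T : WeightedTree V) (d : Pairs V → ℝ) : Prop :=
  ∀ (u v : V) (h : u ≠ v) (p : T.graph.Walk (T.node u) (T.node v)), p.IsPath →
    d (mkPair u v h) = (p.edges.map T.weight).sum

/-- `d` is a tree metric on `V`. -/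
def IsTreeMetric {V : Type} (d : Pairs V → ℝ) : Prop :=
  ∃ T : WeightedTree V, T.Induces d

/-! ### Random access machines

The memory has cells `0, 1, 2, …`, each of which holds a rational number; all but finitely many
hold `0`. Space is counted in bits, time in elementary instructions. An instruction can be
carried out in time polynomial in the number of bits in memory before and after it, so that
polynomially many instructions in polynomial space are polynomial time on a Turing machine. -/

/-- Memory contents. -/
abbrev Mem : Type := ℕ →₀ ℚ

/-- Number of bits of a rational number: numerator, denominator and sign. -/
def bitLength (q : ℚ) : ℕ := Nat.size q.num.natAbs + Nat.size q.den + 1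

/-- Number of bits in memory: each cell in use is charged for its content and its address. -/
def Mem.bits (M : Mem) : ℕ := M.sum fun i q => Nat.size i + bitLength q

/-- Operands: a constant, the content of a cell, or the content of the cell whose address
is held by a cell. -/
inductive Operand : Type
  | lit (q : ℚ)
  | cell (i : ℕ)
  | ind (i : ℕ)

def Operand.eval (M : Mem) : Operand → ℚ
  | .lit q => q
  | .cell i => M i
  | .ind i => M ⌊M i⌋₊

/-- Destinations: a cell, or the cell whose address is held by a cell. -/
inductive Dest : Type
  | cell (i : ℕ)
  | ind (i : ℕ)

def Dest.addr (M : Mem) : Dest → ℕ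
  | .cell i => i
  | .ind i => ⌊M i⌋₊

inductive BinOp : Type
  | add
  | sub
  | mul
  | div

def BinOp.eval : BinOp → ℚ → ℚ → ℚ
  | .add, x, y => x + y
  | .sub, x, y => x - y
  | .mul, x, y => x * y
  | .div, x, y => x / y

/-- Programs. The tests of `ite x y` and `while x y` are `x < y`. -/
inductive Cmd : Type
  | skip
  | assign (d : Dest) (o : BinOp) (x y : Operand)
  | seq (c₁ c₂ : Cmd)
  | ite (x y : Operand) (c₁ c₂ : Cmd)
  | while (x y : Operand) (c : Cmd)

/-- `Exec c M M' t s`: started on the memory `M`, the program `c` halts with memory `M'` after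
`t` steps, and `s` is the largest number of bits in memory during the execution. -/
inductive Exec : Cmd → Mem → Mem → ℕ → ℕ → Prop
  | skip (M : Mem) : Exec .skip M M 1 M.bits
  | assign (M M' : Mem) (d : Dest) (o : BinOp) (x y : Operand)
      (h : M' = M.update (d.addr M) (o.eval (x.eval M) (y.eval M))) :
      Exec (.assign d o x y) M M' 1 (max M.bits M'.bits)
  | seq {c₁ c₂ : Cmd} {M M₁ M₂ : Mem} {t₁ t₂ s₁ s₂ : ℕ}
      (h₁ : Exec c₁ M M₁ t₁ s₁) (h₂ : Exec c₂ M₁ M₂ t₂ s₂) :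
      Exec (.seq c₁ c₂) M M₂ (t₁ + t₂) (max s₁ s₂)
  | ite_true {x y : Operand} {c₁ c₂ : Cmd} {M M' : Mem} {t s : ℕ}
      (hb : x.eval M < y.eval M) (h : Exec c₁ M M' t s) :
      Exec (.ite x y c₁ c₂) M M' (t + 1) s
  | ite_false {x y : Operand} {c₁ c₂ : Cmd} {M M' : Mem} {t s : ℕ}
      (hb : ¬ x.eval M < y.eval M) (h : Exec c₂ M M' t s) :
      Exec (.ite x y c₁ c₂) M M' (t + 1) s
  | while_done {x y : Operand} {c : Cmd} {M : Mem}
      (hb : ¬ x.eval M < y.eval M) :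
      Exec (.while x y c) M M 1 M.bits
  | while_step {x y : Operand} {c : Cmd} {M M₁ M₂ : Mem} {t₁ t₂ s₁ s₂ : ℕ}
      (hb : x.eval M < y.eval M) (h₁ : Exec c M M₁ t₁ s₁)
      (h₂ : Exec (.while x y c) M₁ M₂ t₂ s₂) :
      Exec (.while x y c) M M₂ (t₁ + t₂ + 1) (max s₁ s₂)

/-! ### Streaming algorithms -/

/-- A position of the matrix as it is named in the stream: the two ends of an unordered pair,
in some order. -/
abbrev Item (n : ℕ) : Type := {p : Fin n × Fin n // p.1 ≠ p.2}

/-- The unordered pair named by an item. -/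
def Item.pair {n : ℕ} (a : Item n) : Pairs (Fin n) := mkPair a.1.1 a.1.2 a.2

/-- The order in which the entries of a distance matrix arrive: every unordered pair occurs
exactly once. -/
def IsStream {n : ℕ} (l : List (Item n)) : Prop :=
  (l.map Item.pair).Nodup ∧ ∀ e : Pairs (Fin n), e ∈ l.map Item.pair

/-- Arrival of the entry `(uv, D(uv))`: it is written into the cells `0`, `1` and `2`. -/
noncomputable def feed {n : ℕ} (D : Pairs (Fin n) → ℚ) (a : Item n) (M : Mem) : Mem :=
  ((M.update 0 (a.1.1 : ℕ)).update 1 (a.1.2 : ℕ)).update 2 (D a.pair)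

/-- One pass over the stream: `body` is executed on the arrival of each entry. -/
inductive ExecPass {n : ℕ} (D : Pairs (Fin n) → ℚ) (body : Cmd) :
    List (Item n) → Mem → Mem → ℕ → ℕ → Prop
  | nil (M : Mem) : ExecPass D body [] M M 0 M.bits
  | cons {a : Item n} {l : List (Item n)} {M M₁ M₂ : Mem} {t₁ t₂ s₁ s₂ : ℕ}
      (h₁ : Exec body (feed D a M) M₁ t₁ s₁) (h₂ : ExecPass D body l M₁ M₂ t₂ s₂) :
      ExecPass D body (a :: l) M M₂ (t₁ + t₂ + 1) (max s₁ s₂)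

/-- Successive passes over the same stream. A pass is given by the program to be executed on
the arrival of each entry and the program to be executed at the end of the pass. -/
inductive ExecPasses {n : ℕ} (D : Pairs (Fin n) → ℚ) (l : List (Item n)) :
    List (Cmd × Cmd) → Mem → Mem → ℕ → ℕ → Prop
  | nil (M : Mem) : ExecPasses D l [] M M 0 M.bits
  | cons {body fin : Cmd} {ps : List (Cmd × Cmd)} {M M₁ M₂ M₃ : Mem}
      {t₁ t₂ t₃ s₁ s₂ s₃ : ℕ}
      (h₁ : ExecPass D body l M M₁ t₁ s₁) (h₂ : Exec fin M₁ M₂ t₂ s₂)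
      (h₃ : ExecPasses D l ps M₂ M₃ t₃ s₃) :
      ExecPasses D l ((body, fin) :: ps) M M₃ (t₁ + t₂ + t₃) (max s₁ (max s₂ s₃))

/-- A (deterministic) streaming algorithm: a program to be executed before the first pass, and
the list of the passes. -/
structure StreamAlg where
  init : Cmd
  passes : List (Cmd × Cmd)

/-- On the distance matrix `D` on `{0, …, n-1}` with the entries arriving in the order `l`, the
algorithm halts with memory `M` after `t` steps, and `s` is the largest number of bits in memory.
At the start, cell `0` holds `n` and all other cells hold `0`. -/
def StreamAlg.Run (A : StreamAlg) {n : ℕ} (D : Pairs (Fin n) → ℚ) (l : List (Item n))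
    (M : Mem) (t s : ℕ) : Prop :=
  ∃ (M₀ : Mem) (t₀ s₀ t₁ s₁ : ℕ), Exec A.init (Finsupp.single 0 (n : ℚ)) M₀ t₀ s₀ ∧
    ExecPasses D l A.passes M₀ M t₁ s₁ ∧ t = t₀ + t₁ ∧ s = max s₀ s₁

/-- The memory `M` holds the weighted tree `T`, whose nodes `0, …, n-1` are the elements of
`Fin n`: cell `0` holds the number `N` of nodes, cell `1` holds an address `b`, and for
`k < N - 1` the cells `b+3k`, `b+3k+1` and `b+3k+2` hold the two ends and the length of the
`k`-th edge. -/
def Holds {n : ℕ} (M : Mem) (T : WeightedTree (Fin n)) : Prop :=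
  M 0 = (T.order : ℚ) ∧
  (∀ v : Fin n, (T.node v : ℕ) = (v : ℕ)) ∧
  ∃ b : ℕ, M 1 = (b : ℚ) ∧
    (∀ x y : Fin T.order, T.graph.Adj x y ↔ ∃ k < T.order - 1,
      (M (b + 3 * k) = ((x : ℕ) : ℚ) ∧ M (b + 3 * k + 1) = ((y : ℕ) : ℚ)) ∨
      (M (b + 3 * k) = ((y : ℕ) : ℚ) ∧ M (b + 3 * k + 1) = ((x : ℕ) : ℚ))) ∧
    (∀ x y : Fin T.order, ∀ k < T.order - 1,
      M (b + 3 * k) = ((x : ℕ) : ℚ) → M (b + 3 * k + 1) = ((y : ℕ) : ℚ) →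
        T.weight s(x, y) = (M (b + 3 * k + 2) : ℝ))

end TreeFit

namespace TreeFit

/-! ### Rooted trees given by a parent function -/

section Rooted

variable {N : Type}

/-! Root a tree metric T' at the element 0 and let G(u,v) be the height of the lowest common
ancestor of u and v. Then T'(uv) = G(u,u) + G(v,v) - 2G(u,v), and G obeys the Gromov law: of G(x,y),
G(x,z), G(z,y), the minimum is attained twice (`WeightedTree.exists_gromov`). So fitting a tree
amounts to fitting a function with this law. Put r(v) = D(0v) and let γ(u,v) be (r(u) + r(v) -
D(uv))/2 clipped to the interval from 0 to min(r(u), r(v)). The output is the tree of the least S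
with the Gromov law that lies above γ off the diagonal and above r on it; in fact S(v,v) = r(v). The
first pass collects r, without which no γ can be computed.

Ratio (`norm_sub_le_of_gromov`): let T' have error ε. Then |G(v,v) - r(v)| ≤ ε and γ ≤ G + 3ε/2.
Adding a constant preserves the Gromov law, so minimality gives S ≤ G + 3ε/2, and hence T - D ≥ -6ε.
In the other direction S ≥ γ. If γ was not cut from above, then T ≤ D at that pair; if it was cut to
r(u) or r(v), the triangle inequality for T' gives T - D ≤ 3ε.

Space: off the diagonal S is the bottleneck function of a maximum spanning tree for γ, so n - 1
weighted edges suffice. Maximality is never mentioned, however. A spanning tree is identified with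
the set of Gromov functions above its weights (`Sat`), and the insertion of an edge preserves the
intersection of this set with the constraint of the new edge. In a triangle whose side u, p(u) meets
the constraint, the edge uv may be replaced by p(u)v, after an exchange if uv is the heavier one
(`Pending.climb`, `Pending.exchange`). Parents are smaller than children, so the ends descend until
they coincide.

Output: the elements are attached one at a time, u at height w(u) on the path from p(u) to the root
(`Built.attach`). The heights of the lowest common ancestors are the least Gromov function above the
tree's own edge heights (`Ranked.meet_le_of_isGromov`). `Built.lower` and `Built.upper` translate
between these and the constraints of the spanning tree, which identifies the result with S
(`Output.exists_tree`).

The remainder is a small program logic (`Runs`), which bounds time and memory along with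
correctness. Weights are only copied and compared after γ has been computed, so the lengths of
numbers do not accumulate. -/

open Classical in
/-- The height of the lowest common ancestor of `x` and `y` in the rooted tree with parent
function `par`, whose nodes are at height `h`. -/
noncomputable def meet (par : N → N) (rank : N → ℕ) (h : N → ℝ) (x y : N) : ℝ :=
  if x = y then h x
  else if rank y ≤ rank x then
    -- The guards serve termination only: under `Ranked` they always hold here and the value 0 is
    -- never returned.
    (if rank (par x) < rank x then meet par rank h (par x) y else 0)
  else
    (if rank (par y) < rank y then meet par rank h x (par y) else 0)
termination_by rank x + rank y

/-- `rank` decreases along the parent function, except at the root. -/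
def Ranked (root : N) (par : N → N) (rank : N → ℕ) : Prop :=
  ∀ x, x ≠ root → rank (par x) < rank x

variable {root : N} {par : N → N} {rank : N → ℕ} {h : N → ℝ}

theorem Ranked.root_lt (hr : Ranked root par rank) :
    ∀ x, x ≠ root → rank root < rank x := by
  intro x
  induction hk : rank x using Nat.strong_induction_on generalizing x with
  | _ k ih =>
    intro hx
    have h1 := hr x hx
    by_cases hp : par x = root
    · rw [hp] at h1; omega
    · have := ih (rank (par x)) (by omega) (par x) rfl hp
      omega

theorem Ranked.ne_root (hr : Ranked root par rank) {x y : N} (hxy : x ≠ y)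
    (hle : rank y ≤ rank x) : x ≠ root := by
  rintro rfl
  have := hr.root_lt y (Ne.symm hxy)
  omega

theorem Ranked.par_ne (hr : Ranked root par rank) {x : N} (hx : x ≠ root) : par x ≠ x := by
  intro he
  have := hr x hx
  rw [he] at this
  omega

theorem meet_self (x : N) : meet par rank h x x = h x := by
  rw [meet]; simp

theorem Ranked.meet_left (hr : Ranked root par rank) {x y : N} (hxy : x ≠ y)
    (hle : rank y ≤ rank x) : meet par rank h x y = meet par rank h (par x) y := by
  rw [meet]
  simp [hxy, hle, hr x (hr.ne_root hxy hle)]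

theorem Ranked.meet_right_of_lt (hr : Ranked root par rank) {x y : N}
    (hlt : rank x < rank y) : meet par rank h x y = meet par rank h x (par y) := by
  have hxy : x ≠ y := by rintro rfl; omega
  rw [meet]
  simp [hxy, not_le.mpr hlt, hr y (hr.ne_root hxy.symm hlt.le)]

theorem Ranked.meet_comm (hr : Ranked root par rank) (x y : N) :
    meet par rank h x y = meet par rank h y x := by
  induction hk : rank x + rank y using Nat.strong_induction_on generalizing x y with
  | _ k ih =>
    by_cases hxy : x = y
    · rw [hxy]
    rcases lt_trichotomy (rank x) (rank y) with hlt | heq | hlt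
    · have := hr y (hr.ne_root (Ne.symm hxy) hlt.le)
      rw [hr.meet_right_of_lt hlt, hr.meet_left (Ne.symm hxy) hlt.le]
      exact ih _ (by omega) _ _ rfl
    -- At equal ranks the two orders move different arguments first; after two moves both have
    -- arrived at the pair of parents.
    · have h1 := hr y (hr.ne_root (Ne.symm hxy) heq.le)
      have h2 := hr x (hr.ne_root hxy heq.ge)
      rw [hr.meet_left hxy heq.ge, hr.meet_left (Ne.symm hxy) heq.le,
        hr.meet_right_of_lt (x := par x) (by omega), hr.meet_right_of_lt (x := par y) (by omega)]
      exact ih _ (by omega) _ _ rfl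
    · have := hr x (hr.ne_root hxy hlt.le)
      rw [hr.meet_left hxy hlt.le, hr.meet_right_of_lt hlt]
      exact ih _ (by omega) _ _ rfl

theorem Ranked.meet_right (hr : Ranked root par rank) {x y : N} (hxy : x ≠ y)
    (hle : rank x ≤ rank y) : meet par rank h x y = meet par rank h x (par y) := by
  rw [hr.meet_comm, hr.meet_left (Ne.symm hxy) hle, hr.meet_comm]

/-- Induction along the recursion of `meet`. -/
theorem Ranked.meet_induction (hr : Ranked root par rank) {P : N → N → Prop}
    (self : ∀ x, P x x) (symm : ∀ x y, P x y → P y x)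
    (step : ∀ x y, x ≠ y → x ≠ root → rank y ≤ rank x → P (par x) y → P x y) (x y : N) :
    P x y := by
  induction hk : rank x + rank y using Nat.strong_induction_on generalizing x y with
  | _ k ih =>
    by_cases hxy : x = y
    · subst hxy; exact self x
    rcases le_total (rank y) (rank x) with hle | hle
    · have h0 := hr.ne_root hxy hle
      have := hr x h0
      exact step x y hxy h0 hle (ih _ (by omega) _ _ rfl)
    · have h0 := hr.ne_root (Ne.symm hxy) hle
      have := hr y h0
      exact symm _ _ (step y x (Ne.symm hxy) h0 hle (ih _ (by omega) _ _ rfl))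

theorem Ranked.meet_le (hr : Ranked root par rank) (hm : ∀ x, x ≠ root → h (par x) ≤ h x)
    (x y : N) : meet par rank h x y ≤ h x ∧ meet par rank h x y ≤ h y := by
  refine hr.meet_induction (P := fun x y => meet par rank h x y ≤ h x ∧ meet par rank h x y ≤ h y)
    (fun x => ?_) (fun x y hP => ?_) (fun x y hxy hx hle hP => ?_) x y
  · rw [meet_self]; exact ⟨le_rfl, le_rfl⟩
  · rw [hr.meet_comm]; exact hP.symm
  · rw [hr.meet_left hxy hle]; exact ⟨hP.1.trans (hm x hx), hP.2⟩

theorem Ranked.root_le (hr : Ranked root par rank) (hm : ∀ x, x ≠ root → h (par x) ≤ h x) :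
    ∀ x, h root ≤ h x := by
  intro x
  induction hk : rank x using Nat.strong_induction_on generalizing x with
  | _ k ih =>
    by_cases hx : x = root
    · rw [hx]
    · have := hr x hx
      exact (ih _ (by omega) (par x) rfl).trans (hm x hx)

theorem Ranked.root_le_meet (hr : Ranked root par rank) (hm : ∀ x, x ≠ root → h (par x) ≤ h x)
    (x y : N) : h root ≤ meet par rank h x y := by
  refine hr.meet_induction (P := fun x y => h root ≤ meet par rank h x y)
    (fun x => ?_) (fun x y hP => ?_) (fun x y hxy hx hle hP => ?_) x y
  · rw [meet_self]; exact hr.root_le hm x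
  · rw [hr.meet_comm]; exact hP
  · rw [hr.meet_left hxy hle]; exact hP

theorem Ranked.meet_par (hr : Ranked root par rank) {x : N} (hx : x ≠ root) :
    meet par rank h x (par x) = h (par x) := by
  rw [hr.meet_left (Ne.symm (hr.par_ne hx)) (hr x hx).le, meet_self]

/-! ### The Gromov law and the minimality of ancestor heights -/

/-- Symmetric functions that satisfy the law of Gromov products in a tree. -/
structure IsGromov (S : N → N → ℝ) : Prop where
  symm : ∀ x y, S x y = S y x
  le : ∀ x y z, min (S x z) (S z y) ≤ S x y

theorem IsGromov.trans {S : N → N → ℝ} (hS : IsGromov S) {a : ℝ} {x y z : N} (h₁ : a ≤ S x z)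
    (h₂ : a ≤ S z y) : a ≤ S x y :=
  (le_min h₁ h₂).trans (hS.le x y z)

theorem IsGromov.comp {N' : Type} {S : N → N → ℝ} (hS : IsGromov S) (f : N' → N) :
    IsGromov fun x y => S (f x) (f y) :=
  ⟨fun _ _ => hS.symm _ _, fun _ _ _ => hS.le _ _ _⟩

theorem IsGromov.add_const {S : N → N → ℝ} (hS : IsGromov S) (a : ℝ) :
    IsGromov fun x y => S x y + a := by
  refine ⟨fun x y => by rw [hS.symm], fun x y z => ?_⟩
  rw [min_add_add_right]
  linarith [hS.le x y z]

/-- If the three nodes are distinct, one of largest rank can be replaced by its parent without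
changing the two values in which it occurs. This descends to the case of two equal nodes, where the
law is trivial or says that an ancestor is no higher than its descendant. -/
theorem Ranked.isGromov_meet (hr : Ranked root par rank)
    (hm : ∀ x, x ≠ root → h (par x) ≤ h x) : IsGromov (meet par rank h) := by
  refine ⟨hr.meet_comm, fun x y z => ?_⟩
  induction hk : rank x + rank y + rank z using Nat.strong_induction_on generalizing x y z with
  | _ k ih =>
    by_cases hxz : x = z
    · subst hxz; exact min_le_right _ _
    by_cases hyz : y = z
    · subst hyz; exact min_le_left _ _
    by_cases hxy : x = y
    · subst hxy
      rw [meet_self]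
      exact (min_le_left _ _).trans (hr.meet_le hm x z).1
    by_cases hx : rank y ≤ rank x ∧ rank z ≤ rank x
    · have := hr x (hr.ne_root hxy hx.1)
      rw [hr.meet_left hxz hx.2, hr.meet_left hxy hx.1]
      exact ih _ (by omega) _ _ _ rfl
    by_cases hy : rank x ≤ rank y ∧ rank z ≤ rank y
    · have := hr y (hr.ne_root (Ne.symm hxy) hy.1)
      rw [hr.meet_right hxy hy.1, hr.meet_right (Ne.symm hyz) hy.2]
      exact ih _ (by omega) _ _ _ rfl
    · have hz1 : rank x ≤ rank z := by omega
      have hz2 : rank y ≤ rank z := by omega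
      have := hr z (hr.ne_root (Ne.symm hxz) hz1)
      rw [hr.meet_right hxz hz1, hr.meet_left (Ne.symm hyz) hz2]
      exact ih _ (by omega) _ _ _ rfl

/-- `meet` is the least function with the Gromov law that is bounded below by the heights on the
diagonal and along the edges. -/
theorem Ranked.meet_le_of_isGromov (hr : Ranked root par rank)
    (hm : ∀ x, x ≠ root → h (par x) ≤ h x) {S : N → N → ℝ} (hS : IsGromov S)
    (hself : ∀ x, h x ≤ S x x) (hpar : ∀ x, x ≠ root → h (par x) ≤ S x (par x)) (x y : N) :
    meet par rank h x y ≤ S x y := by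
  refine hr.meet_induction (P := fun x y => meet par rank h x y ≤ S x y)
    (fun x => ?_) (fun x y hP => ?_) (fun x y hxy hx hle hP => ?_) x y
  · rw [meet_self]; exact hself x
  · rw [hr.meet_comm, hS.symm]; exact hP
  · rw [hr.meet_left hxy hle]
    exact hS.trans ((hr.meet_le hm (par x) y).1.trans (hpar x hx)) hP

/-- The clause on the support keeps the induction going: inner nodes have rank below that of one of
the ends, so the end of larger rank is not met again when it is put in front of the path from its
parent. -/
theorem Ranked.exists_path (hr : Ranked root par rank) {G : SimpleGraph N}
    (hG : ∀ x, x ≠ root → G.Adj x (par x)) {wt : Sym2 N → ℝ}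
    (hwt : ∀ x, x ≠ root → wt s(x, par x) = h x - h (par x)) (x y : N) :
    ∃ p : G.Walk x y, p.IsPath ∧
      (∀ v ∈ p.support, v = x ∨ v = y ∨ rank v < max (rank x) (rank y)) ∧
      (p.edges.map wt).sum = h x + h y - 2 * meet par rank h x y := by
  refine hr.meet_induction (P := fun x y => ∃ p : G.Walk x y, p.IsPath ∧
      (∀ v ∈ p.support, v = x ∨ v = y ∨ rank v < max (rank x) (rank y)) ∧
      (p.edges.map wt).sum = h x + h y - 2 * meet par rank h x y)
    (fun x => ?_) (fun x y hP => ?_) (fun x y hxy hx hle hP => ?_) x y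
  · refine ⟨.nil, by simp, by simp, ?_⟩
    rw [meet_self]; simp; ring
  · obtain ⟨p, hp, hs, hw⟩ := hP
    refine ⟨p.reverse, hp.reverse, fun v hv => ?_, ?_⟩
    · rw [SimpleGraph.Walk.support_reverse, List.mem_reverse] at hv
      rw [max_comm]
      rcases hs v hv with h1 | h1 | h1 <;> simp [h1]
    · rw [SimpleGraph.Walk.edges_reverse, List.map_reverse, List.sum_reverse, hw, hr.meet_comm]
      ring
  · obtain ⟨p, hp, hs, hw⟩ := hP
    have hlt := hr x hx
    refine ⟨.cons (hG x hx) p, ?_, fun v hv => ?_, ?_⟩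
    · rw [SimpleGraph.Walk.cons_isPath_iff]
      refine ⟨hp, fun hmem => ?_⟩
      rcases hs x hmem with h1 | h1 | h1
      · exact hr.par_ne hx h1.symm
      · exact hxy h1
      · omega
    · rw [SimpleGraph.Walk.support_cons, List.mem_cons] at hv
      rcases hv with hv | hv
      · exact .inl hv
      rcases hs v hv with h1 | h1 | h1
      · subst h1; right; right; omega
      · exact .inr (.inl h1)
      · right; right; omega
    · rw [SimpleGraph.Walk.edges_cons, List.map_cons, List.sum_cons, hw, hwt x hx,
        hr.meet_left hxy hle]
      ring

/-- The graph of a parent function. -/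
def parentGraph (root : N) (par : N → N) : SimpleGraph N :=
  SimpleGraph.fromRel fun x y => x ≠ root ∧ par x = y

theorem Ranked.parentGraph_adj (hr : Ranked root par rank) {x y : N} :
    (parentGraph root par).Adj x y ↔ (x ≠ root ∧ par x = y) ∨ (y ≠ root ∧ par y = x) := by
  rw [parentGraph, SimpleGraph.fromRel_adj]
  refine ⟨fun hh => hh.2, fun hh => ⟨?_, hh⟩⟩
  rintro rfl
  rcases hh with hh | hh <;> exact hr.par_ne hh.1 hh.2

/-- Every node is connected to the root through its ancestors, and the edges correspond bijectively
to the nodes other than the root; no two nodes share an edge to a parent, as each would then have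
the smaller rank. -/
theorem Ranked.isTree_parentGraph [Finite N] (hr : Ranked root par rank) :
    (parentGraph root par).IsTree := by
  have hG : ∀ x, x ≠ root → (parentGraph root par).Adj x (par x) := fun x hx =>
    hr.parentGraph_adj.mpr (.inl ⟨hx, rfl⟩)
  have hconn : (parentGraph root par).Connected := by
    rw [SimpleGraph.connected_iff_exists_forall_reachable]
    refine ⟨root, fun x => ?_⟩
    induction hk : rank x using Nat.strong_induction_on generalizing x with
    | _ k ih =>
      by_cases hx : x = root
      · rw [hx]
      · exact (ih _ (hk ▸ hr x hx) (par x) rfl).trans (hG x hx).symm.reachable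
  rw [SimpleGraph.isTree_iff_connected_and_card]
  refine ⟨hconn, ?_⟩
  let f : {x : N // x ≠ root} → (parentGraph root par).edgeSet := fun x =>
    ⟨s(x.1, par x.1), hG x.1 x.2⟩
  have hf : Function.Bijective f := by
    constructor
    · rintro ⟨x, hx⟩ ⟨y, hy⟩ hxy
      have h1 : s(x, par x) = s(y, par y) := congrArg Subtype.val hxy
      rw [Sym2.eq_iff] at h1
      rcases h1 with h1 | h1
      · exact Subtype.ext h1.1
      · have a := hr x hx
        have b := hr y hy
        rw [h1.2] at a
        rw [← h1.1] at b
        omega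
    · rintro ⟨e, he⟩
      induction e using Sym2.ind with
      | _ x y =>
        rcases hr.parentGraph_adj.mp he with hh | hh
        · exact ⟨⟨x, hh.1⟩, Subtype.ext (by simp [f, hh.2])⟩
        · exact ⟨⟨y, hh.1⟩, Subtype.ext (by simp [f, hh.2, Sym2.eq_swap])⟩
  rw [← Nat.card_eq_of_bijective f hf]
  have := Fintype.ofFinite N
  classical
  rw [Nat.card_eq_fintype_card, Nat.card_eq_fintype_card, Fintype.card_subtype_compl]
  have : 0 < Fintype.card N := Fintype.card_pos_iff.mpr ⟨root⟩
  simp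
  omega

end Rooted

/-! ### Gromov products of a tree metric -/

/-- The distances in a weighted tree are given by heights over a node and the heights of the
lowest common ancestors, which satisfy the Gromov law. -/
theorem WeightedTree.exists_gromov {V : Type} (T : WeightedTree V) (a : V) :
    ∃ S : V → V → ℝ, IsGromov S ∧ (∀ u v, 0 ≤ S u v) ∧
      (∀ u v, S u v ≤ S u u) ∧ S a a = 0 ∧
      ∀ d, T.Induces d → ∀ u v (huv : u ≠ v),
        d (mkPair u v huv) = S u u + S v v - 2 * S u v := by
  classical
  set r := T.node a with hrdef
  have hex : ∀ x, ∃ p : T.graph.Walk x r, p.IsPath := fun x =>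
    (T.isTree.connected.preconnected x r).exists_isPath
  choose P hP using hex
  let par : Fin T.order → Fin T.order := fun x => (P x).snd
  let rank : Fin T.order → ℕ := fun x => (P x).length
  let h : Fin T.order → ℝ := fun x => ((P x).edges.map T.weight).sum
  -- Paths in a tree are unique, so the path from `x` to the root without its first edge is the
  -- chosen path from `par x`.
  have key : ∀ x, x ≠ r → ∃ hadj : T.graph.Adj x (par x),
      P x = .cons hadj (P (par x)) := by
    intro x hx
    have hn : ¬ (P x).Nil := SimpleGraph.Walk.not_nil_of_ne hx
    refine ⟨(P x).adj_snd hn, ?_⟩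
    have h1 := (P x).cons_tail_eq hn
    have h2 : (P x).tail.IsPath := (hP x).tail
    have h3 : (P x).tail = P (par x) := by
      have := T.isTree.isAcyclic.subsingleton_path (par x) r
      exact congrArg Subtype.val (this.elim ⟨_, h2⟩ ⟨_, hP (par x)⟩)
    rw [← h3]
    exact h1.symm
  have hr : Ranked r par rank := by
    intro x hx
    obtain ⟨hadj, he⟩ := key x hx
    change (P (par x)).length < (P x).length
    conv_rhs => rw [he]
    simp
  have hh : ∀ x, x ≠ r → h x = T.weight s(x, par x) + h (par x) := by
    intro x hx
    obtain ⟨hadj, he⟩ := key x hx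
    change ((P x).edges.map T.weight).sum = _
    conv_lhs => rw [he]
    simp [h]
  have hm : ∀ x, x ≠ r → h (par x) ≤ h x := fun x hx => by
    rw [hh x hx]; linarith [T.weight_nonneg s(x, par x)]
  have hroot : h r = 0 := by
    have : P r = .nil := SimpleGraph.Walk.eq_nil_iff_nil.mpr
      (SimpleGraph.Walk.isPath_iff_nil.mp (hP r))
    simp [h, this]
  have hgr := hr.isGromov_meet hm
  refine ⟨fun u v => meet par rank h (T.node u) (T.node v), hgr.comp _, fun u v => ?_,
    fun u v => ?_, ?_, ?_⟩
  · rw [← hroot]; exact hr.root_le_meet hm _ _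
  · dsimp only; rw [meet_self]; exact (hr.meet_le hm _ _).1
  · dsimp only; rw [meet_self]; exact hroot
  · intro d hd u v huv
    obtain ⟨p, hp, -, hw⟩ := hr.exists_path (G := T.graph) (h := h) (wt := T.weight)
      (fun x hx => (key x hx).1) (fun x hx => by rw [hh x hx]; ring) (T.node u) (T.node v)
    dsimp only
    rw [hd u v huv p hp, hw, meet_self, meet_self]

/-! ### Lengths of rational numbers -/

theorem size_mul_le (a b : ℕ) : Nat.size (a * b) ≤ Nat.size a + Nat.size b := by
  rw [Nat.size_le, pow_add]
  exact Nat.mul_lt_mul'' (Nat.lt_size_self a) (Nat.lt_size_self b)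

theorem size_add_le (a b : ℕ) : Nat.size (a + b) ≤ max (Nat.size a) (Nat.size b) + 1 := by
  rw [Nat.size_le, pow_succ]
  have h1 : a < 2 ^ max (Nat.size a) (Nat.size b) :=
    (Nat.lt_size_self a).trans_le (Nat.pow_le_pow_right (by norm_num) (le_max_left _ _))
  have h2 : b < 2 ^ max (Nat.size a) (Nat.size b) :=
    (Nat.lt_size_self b).trans_le (Nat.pow_le_pow_right (by norm_num) (le_max_right _ _))
  omega

theorem bitLength_le_of_eq_div {q : ℚ} {a : ℤ} {b : ℕ} (hb : b ≠ 0) (h : q = a / b) :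
    bitLength q ≤ Nat.size a.natAbs + Nat.size b + 1 := by
  subst h
  have h1 : ((a : ℚ) / (b : ℚ)).den ∣ b := by
    have := Rat.den_dvd a b
    exact_mod_cast this
  have h2 : ((a : ℚ) / (b : ℚ)).num ∣ a := by
    have := Rat.num_dvd a (b := (b : ℤ)) (by exact_mod_cast hb)
    rwa [Rat.divInt_eq_div] at this
  unfold bitLength
  have h3 : ((a : ℚ) / (b : ℚ)).num.natAbs ≤ a.natAbs := by
    by_cases ha : a = 0
    · simp [ha]
    · exact Nat.le_of_dvd (Int.natAbs_pos.mpr ha) (Int.natAbs_dvd_natAbs.mpr h2)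
  have := Nat.size_le_size h3
  have := Nat.size_le_size (Nat.le_of_dvd (Nat.pos_of_ne_zero hb) h1)
  omega

theorem bitLength_natCast (k : ℕ) : bitLength (k : ℚ) = Nat.size k + 2 := by
  simp [bitLength]

/-- A crude factor is enough, since every number computed is a bounded number of operations away
from the input. -/
theorem bitLength_add_le (x y : ℚ) : bitLength (x + y) ≤ 2 * (bitLength x + bitLength y) := by
  have h := bitLength_le_of_eq_div (q := x + y) (a := x.num * y.den + y.num * x.den)
    (b := x.den * y.den) (Nat.mul_ne_zero x.den_nz y.den_nz) (by
      conv_lhs => rw [← Rat.num_div_den x, ← Rat.num_div_den y]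
      have := x.den_nz
      have := y.den_nz
      push_cast
      field_simp)
  refine h.trans ?_
  have h1 := Nat.size_le_size (Int.natAbs_add_le (x.num * y.den) (y.num * x.den))
  have h2 := size_add_le (x.num * y.den).natAbs (y.num * x.den).natAbs
  rw [Int.natAbs_mul, Int.natAbs_mul, Int.natAbs_natCast, Int.natAbs_natCast] at h1 h2
  have h3 := size_mul_le x.num.natAbs y.den
  have h4 := size_mul_le y.num.natAbs x.den
  have h5 := size_mul_le x.den y.den
  unfold bitLength
  omega

theorem bitLength_neg (x : ℚ) : bitLength (-x) = bitLength x := by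
  simp [bitLength]

theorem bitLength_sub_le (x y : ℚ) : bitLength (x - y) ≤ 2 * (bitLength x + bitLength y) := by
  rw [sub_eq_add_neg, ← bitLength_neg y]
  exact bitLength_add_le _ _

theorem bitLength_div_two_le (x : ℚ) : bitLength (x / 2) ≤ bitLength x + 2 := by
  have h := bitLength_le_of_eq_div (q := x / 2) (a := x.num)
    (b := x.den * 2) (Nat.mul_ne_zero x.den_nz (by norm_num)) (by
      conv_lhs => rw [← Rat.num_div_den x]
      push_cast
      field_simp)
  refine h.trans ?_
  have h5 := size_mul_le x.den 2
  have : Nat.size 2 = 2 := by decide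
  unfold bitLength
  omega

/-! ### Bounded memories -/

/-- The first `L` cells contain everything, and each content has at most `B` bits. -/
def Bounded (L B : ℕ) (M : Mem) : Prop :=
  (∀ i, L ≤ i → M i = 0) ∧ ∀ i, bitLength (M i) ≤ B

/-- The number of bits in a bounded memory. -/
def spaceBound (L B : ℕ) : ℕ := L * (Nat.size L + B)

theorem Bounded.bits_le {L B : ℕ} {M : Mem} (h : Bounded L B M) : M.bits ≤ spaceBound L B := by
  have hs : M.support ⊆ Finset.range L := by
    intro i hi
    rw [Finset.mem_range]
    by_contra hL
    exact (Finsupp.mem_support_iff.mp hi) (h.1 i (not_lt.mp hL))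
  unfold Mem.bits Finsupp.sum
  calc ∑ i ∈ M.support, (Nat.size i + bitLength (M i))
      ≤ ∑ i ∈ M.support, (Nat.size L + B) := by
        refine Finset.sum_le_sum fun i hi => ?_
        have := Finset.mem_range.mp (hs hi)
        exact Nat.add_le_add (Nat.size_le_size this.le) (h.2 i)
    _ = M.support.card * (Nat.size L + B) := by rw [Finset.sum_const, smul_eq_mul]
    _ ≤ spaceBound L B := by
        refine Nat.mul_le_mul_right _ ?_
        simpa using Finset.card_le_card hs

theorem Bounded.update {L B : ℕ} {M : Mem} (h : Bounded L B M) {i : ℕ} {q : ℚ} (hi : i < L)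
    (hq : bitLength q ≤ B) : Bounded L B (M.update i q) := by
  refine ⟨fun j hj => ?_, fun j => ?_⟩
  · rw [Finsupp.coe_update, Function.update_of_ne (by omega)]
    exact h.1 j hj
  · rw [Finsupp.coe_update]
    by_cases hji : j = i
    · rw [hji, Function.update_self]; exact hq
    · rw [Function.update_of_ne hji]; exact h.2 j

/-! ### Abstract states

Cells `0`, `1` and `4` to `8` serve as registers for natural numbers, cells `2` and `9` to `11`
as registers for rational numbers, and cell `3` for addresses. From cell `12` on, the memory is
a table of records of three cells, of which the middle one holds a natural number. -/

structure State where
  nat : ℕ → ℕ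
  rat : ℕ → ℚ
  fst : ℕ → ℚ
  mid : ℕ → ℕ
  lst : ℕ → ℚ

def IsNatReg (i : ℕ) : Prop := i < 2 ∨ 4 ≤ i ∧ i < 9

def IsRatReg (i : ℕ) : Prop := i = 2 ∨ 9 ≤ i ∧ i < 12

instance (i : ℕ) : Decidable (IsNatReg i) :=
  inferInstanceAs (Decidable (i < 2 ∨ 4 ≤ i ∧ i < 9))

instance (i : ℕ) : Decidable (IsRatReg i) :=
  inferInstanceAs (Decidable (i = 2 ∨ 9 ≤ i ∧ i < 12))

/-- The number of cells used for instances of order `n`. -/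
def cells (n : ℕ) : ℕ := 12 + 6 * n

/-- The memory `M` is described by the state `σ`. -/
structure Rep (n B : ℕ) (σ : State) (M : Mem) : Prop where
  nat : ∀ i, IsNatReg i → M i = σ.nat i
  rat : ∀ i, IsRatReg i → M i = σ.rat i
  fst : ∀ j, M (12 + 3 * j) = σ.fst j
  mid : ∀ j, M (12 + 3 * j + 1) = σ.mid j
  lst : ∀ j, M (12 + 3 * j + 2) = σ.lst j
  bounded : Bounded (cells n) B M

/-- Operands that can be read off the registers. -/
def Operand.Direct : Operand → Prop
  | .lit _ => True
  | .cell i => IsNatReg i ∨ IsRatReg i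
  | .ind _ => False

instance : (x : Operand) → Decidable x.Direct
  | .lit _ => inferInstanceAs (Decidable True)
  | .cell i => inferInstanceAs (Decidable (IsNatReg i ∨ IsRatReg i))
  | .ind _ => inferInstanceAs (Decidable False)

def State.eval (σ : State) : Operand → ℚ
  | .lit q => q
  | .cell i => if IsNatReg i then (σ.nat i : ℚ) else σ.rat i
  | .ind _ => 0

theorem Rep.eval {n B : ℕ} {σ : State} {M : Mem} (h : Rep n B σ M) {x : Operand}
    (hx : x.Direct) : x.eval M = σ.eval x := by
  cases x with
  | lit q => rfl
  | cell i =>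
    by_cases hi : IsNatReg i
    · simp [Operand.eval, State.eval, hi, h.nat i hi]
    · simp [Operand.eval, State.eval, hi, h.rat i (hx.resolve_left hi)]
  | ind i => exact hx.elim

/-- Started on any memory described by `σ`, the program `c` halts within `T` steps, in a memory
described by a state with the property `Q`, and all memories on the way are bounded. -/
def Runs (n B : ℕ) (c : Cmd) (σ : State) (T : ℕ) (Q : State → Prop) : Prop :=
  ∀ M, Rep n B σ M → ∃ (M' : Mem) (t s : ℕ) (σ' : State), Exec c M M' t s ∧ t ≤ T ∧
    s ≤ spaceBound (cells n) B ∧ Rep n B σ' M' ∧ Q σ'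

namespace Runs

variable {n B : ℕ} {σ : State} {T : ℕ} {Q : State → Prop}

/-- Any positive time budget is allowed, which lets the two branches of a test share one bound. -/
theorem skip (h : Q σ) : Runs n B .skip σ (T + 1) Q := fun M hM =>
  ⟨M, 1, M.bits, σ, .skip M, by omega, hM.bounded.bits_le, hM, h⟩

theorem seq {c₁ c₂ : Cmd} {T₁ T₂ : ℕ} {R : State → Prop} (h₁ : Runs n B c₁ σ T₁ R)
    (h₂ : ∀ σ', R σ' → Runs n B c₂ σ' T₂ Q) : Runs n B (.seq c₁ c₂) σ (T₁ + T₂) Q := by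
  intro M hM
  obtain ⟨M₁, t₁, s₁, σ₁, e₁, ht₁, hs₁, r₁, q₁⟩ := h₁ M hM
  obtain ⟨M₂, t₂, s₂, σ₂, e₂, ht₂, hs₂, r₂, q₂⟩ := h₂ σ₁ q₁ M₁ r₁
  exact ⟨M₂, _, _, σ₂, .seq e₁ e₂, by omega, max_le hs₁ hs₂, r₂, q₂⟩

theorem mono {c : Cmd} {T' : ℕ} {R : State → Prop} (h : Runs n B c σ T R) (hT : T ≤ T')
    (hR : ∀ σ', R σ' → Q σ') : Runs n B c σ T' Q := by
  intro M hM
  obtain ⟨M₁, t₁, s₁, σ₁, e₁, ht₁, hs₁, r₁, q₁⟩ := h M hM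
  exact ⟨M₁, t₁, s₁, σ₁, e₁, ht₁.trans hT, hs₁, r₁, hR _ q₁⟩

theorem ite {x y : Operand} {c₁ c₂ : Cmd} (hx : x.Direct) (hy : y.Direct)
    (h₁ : σ.eval x < σ.eval y → Runs n B c₁ σ T Q)
    (h₂ : ¬ σ.eval x < σ.eval y → Runs n B c₂ σ T Q) :
    Runs n B (.ite x y c₁ c₂) σ (T + 1) Q := by
  intro M hM
  by_cases hb : x.eval M < y.eval M
  · obtain ⟨M₁, t₁, s₁, σ₁, e₁, ht₁, hs₁, r₁, q₁⟩ :=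
      h₁ (by rwa [← hM.eval hx, ← hM.eval hy]) M hM
    exact ⟨M₁, _, s₁, σ₁, .ite_true hb e₁, by omega, hs₁, r₁, q₁⟩
  · obtain ⟨M₁, t₁, s₁, σ₁, e₁, ht₁, hs₁, r₁, q₁⟩ :=
      h₂ (by rwa [← hM.eval hx, ← hM.eval hy]) M hM
    exact ⟨M₁, _, s₁, σ₁, .ite_false hb e₁, by omega, hs₁, r₁, q₁⟩

/-- The rule for loops, with an invariant `I k` in which `k` bounds the number of iterations
still to come. -/
theorem loop {x y : Operand} {c : Cmd} (hx : x.Direct) (hy : y.Direct) (I : ℕ → State → Prop)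
    (hstep : ∀ k σ, I k σ → σ.eval x < σ.eval y →
      Runs n B c σ T fun σ' => ∃ k' < k, I k' σ')
    (hdone : ∀ k σ, I k σ → ¬ σ.eval x < σ.eval y → Q σ) (k : ℕ) (h : I k σ) :
    Runs n B (.while x y c) σ ((T + 1) * k + 1) Q := by
  induction k using Nat.strong_induction_on generalizing σ with
  | _ k ih =>
    intro M hM
    by_cases hb : x.eval M < y.eval M
    · obtain ⟨M₁, t₁, s₁, σ₁, e₁, ht₁, hs₁, r₁, k', hk', hI⟩ :=
        hstep k σ h (by rwa [← hM.eval hx, ← hM.eval hy]) M hM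
      obtain ⟨M₂, t₂, s₂, σ₂, e₂, ht₂, hs₂, r₂, q₂⟩ := ih k' hk' hI M₁ r₁
      refine ⟨M₂, _, _, σ₂, .while_step hb e₁ e₂, ?_, max_le hs₁ hs₂, r₂, q₂⟩
      have : (T + 1) * (k' + 1) ≤ (T + 1) * k := Nat.mul_le_mul_left _ hk'
      rw [mul_add] at this
      omega
    · exact ⟨M, _, _, σ, .while_done hb, by omega, hM.bounded.bits_le, hM,
        hdone k σ h (by rwa [← hM.eval hx, ← hM.eval hy])⟩

end Runs

theorem exec_assign {L B : ℕ} {M : Mem} (h : Bounded L B M) (d : Dest) (o : BinOp)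
    (x y : Operand) (hd : d.addr M < L) (hq : bitLength (o.eval (x.eval M) (y.eval M)) ≤ B) :
    ∃ s, Exec (.assign d o x y) M (M.update (d.addr M) (o.eval (x.eval M) (y.eval M))) 1 s ∧
      s ≤ spaceBound L B ∧
      Bounded L B (M.update (d.addr M) (o.eval (x.eval M) (y.eval M))) :=
  ⟨_, .assign M _ d o x y rfl, max_le h.bits_le (h.update hd hq).bits_le, h.update hd hq⟩

theorem Rep.update_nat {n B : ℕ} {σ : State} {M : Mem} (h : Rep n B σ M) {i k : ℕ}
    (hi : IsNatReg i) (hk : bitLength (k : ℚ) ≤ B) :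
    Rep n B { σ with nat := Function.update σ.nat i k } (M.update i (k : ℚ)) := by
  have hlt : i < 12 := by rcases hi with h | h <;> omega
  refine ⟨fun j hj => ?_, fun j hj => ?_, fun j => ?_, fun j => ?_, fun j => ?_,
    h.bounded.update (by unfold cells; omega) hk⟩ <;> rw [Finsupp.coe_update]
  · by_cases hji : j = i
    · simp [hji]
    · simp [hji, h.nat j hj]
  · have : j ≠ i := by
      rintro rfl; unfold IsNatReg at hi; unfold IsRatReg at hj; omega
    simp [this, h.rat j hj]
  · rw [Function.update_of_ne (by omega)]; exact h.fst j
  · rw [Function.update_of_ne (by omega)]; exact h.mid j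
  · rw [Function.update_of_ne (by omega)]; exact h.lst j

theorem Rep.update_rat {n B : ℕ} {σ : State} {M : Mem} (h : Rep n B σ M) {i : ℕ} {q : ℚ}
    (hi : IsRatReg i) (hq : bitLength q ≤ B) :
    Rep n B { σ with rat := Function.update σ.rat i q } (M.update i q) := by
  have hlt : i < 12 := by rcases hi with h | h <;> omega
  refine ⟨fun j hj => ?_, fun j hj => ?_, fun j => ?_, fun j => ?_, fun j => ?_,
    h.bounded.update (by unfold cells; omega) hq⟩ <;> rw [Finsupp.coe_update]
  · have : j ≠ i := by
      rintro rfl; unfold IsRatReg at hi; unfold IsNatReg at hj; omega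
    simp [this, h.nat j hj]
  · by_cases hji : j = i
    · simp [hji]
    · simp [hji, h.rat j hj]
  · rw [Function.update_of_ne (by omega)]; exact h.fst j
  · rw [Function.update_of_ne (by omega)]; exact h.mid j
  · rw [Function.update_of_ne (by omega)]; exact h.lst j

/-- Cell `3` is invisible to the abstract state, so address computations leave the state unchanged.
-/
theorem Rep.update_addr {n B : ℕ} {σ : State} {M : Mem} (h : Rep n B σ M) {q : ℚ}
    (hq : bitLength q ≤ B) : Rep n B σ (M.update 3 q) := by
  refine ⟨fun j hj => ?_, fun j hj => ?_, fun j => ?_, fun j => ?_, fun j => ?_,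
    h.bounded.update (by unfold cells; omega) hq⟩ <;> rw [Finsupp.coe_update]
  · rw [Function.update_of_ne (by unfold IsNatReg at hj; omega)]; exact h.nat j hj
  · rw [Function.update_of_ne (by unfold IsRatReg at hj; omega)]; exact h.rat j hj
  · rw [Function.update_of_ne (by omega)]; exact h.fst j
  · rw [Function.update_of_ne (by omega)]; exact h.mid j
  · rw [Function.update_of_ne (by omega)]; exact h.lst j

theorem Rep.update_fst {n B : ℕ} {σ : State} {M : Mem} (h : Rep n B σ M) {i : ℕ} {q : ℚ}
    (hi : i < 2 * n) (hq : bitLength q ≤ B) :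
    Rep n B { σ with fst := Function.update σ.fst i q } (M.update (12 + 3 * i) q) := by
  refine ⟨fun j hj => ?_, fun j hj => ?_, fun j => ?_, fun j => ?_, fun j => ?_,
    h.bounded.update (by unfold cells; omega) hq⟩ <;> rw [Finsupp.coe_update]
  · rw [Function.update_of_ne (by unfold IsNatReg at hj; omega)]; exact h.nat j hj
  · rw [Function.update_of_ne (by unfold IsRatReg at hj; omega)]; exact h.rat j hj
  · by_cases hji : j = i
    · simp [hji]
    · rw [Function.update_of_ne (by omega)]; simp [hji, h.fst j]
  · rw [Function.update_of_ne (by omega)]; exact h.mid j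
  · rw [Function.update_of_ne (by omega)]; exact h.lst j

theorem Rep.update_mid {n B : ℕ} {σ : State} {M : Mem} (h : Rep n B σ M) {i k : ℕ}
    (hi : i < 2 * n) (hk : bitLength (k : ℚ) ≤ B) :
    Rep n B { σ with mid := Function.update σ.mid i k } (M.update (12 + 3 * i + 1) (k : ℚ)) := by
  refine ⟨fun j hj => ?_, fun j hj => ?_, fun j => ?_, fun j => ?_, fun j => ?_,
    h.bounded.update (by unfold cells; omega) hk⟩ <;> rw [Finsupp.coe_update]
  · rw [Function.update_of_ne (by unfold IsNatReg at hj; omega)]; exact h.nat j hj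
  · rw [Function.update_of_ne (by unfold IsRatReg at hj; omega)]; exact h.rat j hj
  · rw [Function.update_of_ne (by omega)]; exact h.fst j
  · by_cases hji : j = i
    · simp [hji]
    · rw [Function.update_of_ne (by omega)]; simp [hji, h.mid j]
  · rw [Function.update_of_ne (by omega)]; exact h.lst j

theorem Rep.update_lst {n B : ℕ} {σ : State} {M : Mem} (h : Rep n B σ M) {i : ℕ} {q : ℚ}
    (hi : i < 2 * n) (hq : bitLength q ≤ B) :
    Rep n B { σ with lst := Function.update σ.lst i q } (M.update (12 + 3 * i + 2) q) := by
  refine ⟨fun j hj => ?_, fun j hj => ?_, fun j => ?_, fun j => ?_, fun j => ?_,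
    h.bounded.update (by unfold cells; omega) hq⟩ <;> rw [Finsupp.coe_update]
  · rw [Function.update_of_ne (by unfold IsNatReg at hj; omega)]; exact h.nat j hj
  · rw [Function.update_of_ne (by unfold IsRatReg at hj; omega)]; exact h.rat j hj
  · rw [Function.update_of_ne (by omega)]; exact h.fst j
  · rw [Function.update_of_ne (by omega)]; exact h.mid j
  · by_cases hji : j = i
    · simp [hji]
    · rw [Function.update_of_ne (by omega)]; simp [hji, h.lst j]

/-! ### Instructions on registers and records -/

/-- All addresses and indices that occur fit in `B` bits. -/
def Fits (n B : ℕ) : Prop := ∀ k ≤ cells n, bitLength (k : ℚ) ≤ B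

/-- Puts the address of the field `f` of the record whose index is in the register `j` into
cell `3`. -/
def address (j f : ℕ) : Cmd :=
  .seq (.assign (.cell 3) .mul (.lit 3) (.cell j))
    (.assign (.cell 3) .add (.cell 3) (.lit ((12 + f : ℕ) : ℚ)))

/-- Loads a field of a record into the register `i`. -/
def load (i j f : ℕ) : Cmd :=
  .seq (address j f) (.assign (.cell i) .add (.ind 3) (.lit 0))

/-- Stores the register `i` in a field of a record. -/
def store (j f i : ℕ) : Cmd :=
  .seq (address j f) (.assign (.ind 3) .add (.cell i) (.lit 0))

theorem exec_address {n B : ℕ} {σ : State} {M : Mem} (hB : Fits n B) (h : Rep n B σ M) {j f : ℕ}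
    (hj : IsNatReg j) (hjn : σ.nat j < 2 * n) (hf : f < 3) :
    ∃ (M' : Mem) (s : ℕ), Exec (address j f) M M' 2 s ∧ s ≤ spaceBound (cells n) B ∧
      Rep n B σ M' ∧ M' 3 = ((12 + 3 * σ.nat j + f : ℕ) : ℚ) := by
  have v1 : BinOp.mul.eval ((Operand.lit 3).eval M) ((Operand.cell j).eval M)
      = ((3 * σ.nat j : ℕ) : ℚ) := by
    simp [BinOp.eval, Operand.eval, h.nat j hj]
  have b1 : bitLength ((3 * σ.nat j : ℕ) : ℚ) ≤ B := hB _ (by unfold cells; omega)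
  obtain ⟨s₁, e₁, hs₁, -⟩ := exec_assign h.bounded (.cell 3) .mul (.lit 3) (.cell j)
    (by simp [Dest.addr, cells]; omega) (by rw [v1]; exact b1)
  rw [v1] at e₁
  have r₁ := h.update_addr b1
  change Exec _ M (M.update 3 _) 1 s₁ at e₁
  set M₁ := M.update 3 ((3 * σ.nat j : ℕ) : ℚ) with hM₁
  have v2 : BinOp.add.eval ((Operand.cell 3).eval M₁)
      ((Operand.lit ((12 + f : ℕ) : ℚ)).eval M₁) = ((12 + 3 * σ.nat j + f : ℕ) : ℚ) := by
    simp [BinOp.eval, Operand.eval, hM₁]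
    ring
  have b2 : bitLength ((12 + 3 * σ.nat j + f : ℕ) : ℚ) ≤ B := hB _ (by unfold cells; omega)
  obtain ⟨s₂, e₂, hs₂, -⟩ := exec_assign r₁.bounded (.cell 3) .add (.cell 3)
    (.lit ((12 + f : ℕ) : ℚ)) (by simp [Dest.addr, cells]; omega) (by rw [v2]; exact b2)
  rw [v2] at e₂
  exact ⟨_, _, .seq e₁ e₂, max_le hs₁ hs₂, r₁.update_addr b2, by simp [Dest.addr]⟩

theorem exec_load {n B : ℕ} {σ : State} {M : Mem} (hB : Fits n B) (h : Rep n B σ M) {i j f : ℕ}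
    (hi : i < 12) (hj : IsNatReg j) (hjn : σ.nat j < 2 * n) (hf : f < 3) :
    ∃ (M' : Mem) (s : ℕ), Exec (load i j f) M (M'.update i (M' (12 + 3 * σ.nat j + f))) 3 s ∧
      s ≤ spaceBound (cells n) B ∧ Rep n B σ M' := by
  obtain ⟨M₁, s₁, e₁, hs₁, r₁, ha⟩ := exec_address hB h hj hjn hf
  have v : BinOp.add.eval ((Operand.ind 3).eval M₁) ((Operand.lit 0).eval M₁)
      = M₁ (12 + 3 * σ.nat j + f) := by
    simp only [BinOp.eval, Operand.eval, ha, Nat.floor_natCast, add_zero]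
  obtain ⟨s₂, e₂, hs₂, -⟩ := exec_assign r₁.bounded (.cell i) .add (.ind 3) (.lit 0)
    (by simp [Dest.addr, cells]; omega) (by rw [v]; exact r₁.bounded.2 _)
  rw [v] at e₂
  exact ⟨M₁, _, .seq e₁ e₂, max_le hs₁ hs₂, r₁⟩

theorem exec_store {n B : ℕ} {σ : State} {M : Mem} (hB : Fits n B) (h : Rep n B σ M) {i j f : ℕ}
    (hi : (Operand.cell i).Direct) (hj : IsNatReg j) (hjn : σ.nat j < 2 * n) (hf : f < 3) :
    ∃ (M' : Mem) (s : ℕ),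
      Exec (store j f i) M (M'.update (12 + 3 * σ.nat j + f) (σ.eval (.cell i))) 3 s ∧
      s ≤ spaceBound (cells n) B ∧ Rep n B σ M' ∧ bitLength (σ.eval (.cell i)) ≤ B := by
  obtain ⟨M₁, s₁, e₁, hs₁, r₁, ha⟩ := exec_address hB h hj hjn hf
  have v : BinOp.add.eval ((Operand.cell i).eval M₁) ((Operand.lit 0).eval M₁)
      = σ.eval (.cell i) := by
    rw [r₁.eval hi]; simp [BinOp.eval, Operand.eval]
  have b : bitLength (σ.eval (.cell i)) ≤ B := by
    rw [← r₁.eval hi]; exact r₁.bounded.2 _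
  have hd : (Dest.ind 3).addr M₁ = 12 + 3 * σ.nat j + f := by
    simp only [Dest.addr, ha, Nat.floor_natCast]
  obtain ⟨s₂, e₂, hs₂, -⟩ := exec_assign r₁.bounded (.ind 3) .add (.cell i) (.lit 0)
    (by rw [hd]; unfold cells; omega) (by rw [v]; exact b)
  rw [v, hd] at e₂
  exact ⟨M₁, _, .seq e₁ e₂, max_le hs₁ hs₂, r₁, b⟩

namespace Runs

variable {n B : ℕ} {σ : State} {T : ℕ} {Q : State → Prop} {c : Cmd}

/-- Symbolic execution: an instruction with a known effect is peeled off the front and the rest is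
verified from the updated state. The rules below are instances. -/
theorem of_exec {c₁ : Cmd} {T₁ : ℕ} {σ' : State} (h : ∀ M, Rep n B σ M → ∃ (M' : Mem) (s : ℕ),
      Exec c₁ M M' T₁ s ∧ s ≤ spaceBound (cells n) B ∧ Rep n B σ' M')
    (hc : Runs n B c σ' T Q) : Runs n B (.seq c₁ c) σ (T + T₁) Q := by
  rw [add_comm]
  refine seq (R := fun τ => τ = σ') (fun M hM => ?_) (fun τ hτ => hτ ▸ hc)
  obtain ⟨M', s, e, hs, r⟩ := h M hM
  exact ⟨M', _, s, σ', e, le_rfl, hs, r, rfl⟩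

theorem setNat {i : ℕ} {o : BinOp} {x y : Operand} (hB : Fits n B) (k : ℕ) (hi : IsNatReg i)
    (hx : x.Direct) (hy : y.Direct) (hv : o.eval (σ.eval x) (σ.eval y) = k) (hk : k ≤ cells n)
    (hc : Runs n B c { σ with nat := Function.update σ.nat i k } T Q) :
    Runs n B (.seq (.assign (.cell i) o x y) c) σ (T + 1) Q := by
  refine of_exec (fun M hM => ?_) hc
  have v : o.eval (x.eval M) (y.eval M) = k := by rw [hM.eval hx, hM.eval hy, hv]
  obtain ⟨s, e, hs, -⟩ := exec_assign hM.bounded (.cell i) o x y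
    (by unfold IsNatReg at hi; simp only [Dest.addr, cells]; omega) (by rw [v]; exact hB k hk)
  rw [v] at e
  exact ⟨_, s, e, hs, hM.update_nat hi (hB k hk)⟩

theorem setRat {i : ℕ} {o : BinOp} {x y : Operand} (hi : IsRatReg i)
    (hx : x.Direct) (hy : y.Direct) (hb : bitLength (o.eval (σ.eval x) (σ.eval y)) ≤ B)
    (hc : Runs n B c
      { σ with rat := Function.update σ.rat i (o.eval (σ.eval x) (σ.eval y)) } T Q) :
    Runs n B (.seq (.assign (.cell i) o x y) c) σ (T + 1) Q := by
  refine of_exec (fun M hM => ?_) hc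
  have v : o.eval (x.eval M) (y.eval M) = o.eval (σ.eval x) (σ.eval y) := by
    rw [hM.eval hx, hM.eval hy]
  obtain ⟨s, e, hs, -⟩ := exec_assign hM.bounded (.cell i) o x y
    (by unfold IsRatReg at hi; simp only [Dest.addr, cells]; omega) (by rw [v]; exact hb)
  rw [v] at e
  exact ⟨_, s, e, hs, hM.update_rat hi hb⟩

/-- Unlike `setRat`, this requires no bound on the length of the value: what is copied already lies
in a bounded memory. -/
theorem copyRat {i j : ℕ} (hi : IsRatReg i) (hj : IsRatReg j)
    (hc : Runs n B c { σ with rat := Function.update σ.rat i (σ.rat j) } T Q) :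
    Runs n B (.seq (.assign (.cell i) .add (.cell j) (.lit 0)) c) σ (T + 1) Q := by
  refine of_exec (fun M hM => ?_) hc
  have v : BinOp.add.eval ((Operand.cell j).eval M) ((Operand.lit 0).eval M) = σ.rat j := by
    simp [BinOp.eval, Operand.eval, hM.rat j hj]
  have b : bitLength (σ.rat j) ≤ B := by rw [← hM.rat j hj]; exact hM.bounded.2 j
  obtain ⟨s, e, hs, -⟩ := exec_assign hM.bounded (.cell i) .add (.cell j) (.lit 0)
    (by unfold IsRatReg at hi; simp only [Dest.addr, cells]; omega) (by rw [v]; exact b)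
  rw [v] at e
  exact ⟨_, s, e, hs, hM.update_rat hi b⟩

theorem loadFst {i j : ℕ} (hB : Fits n B) (hi : IsRatReg i) (hj : IsNatReg j)
    (hjn : σ.nat j < 2 * n)
    (hc : Runs n B c { σ with rat := Function.update σ.rat i (σ.fst (σ.nat j)) } T Q) :
    Runs n B (.seq (load i j 0) c) σ (T + 3) Q := by
  refine of_exec (fun M hM => ?_) hc
  obtain ⟨M', s, e, hs, r⟩ := exec_load hB hM (i := i) (f := 0)
    (by unfold IsRatReg at hi; omega) hj hjn (by omega)
  refine ⟨_, s, e, hs, ?_⟩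
  have hb := r.bounded.2 (12 + 3 * σ.nat j)
  rw [add_zero, r.fst] at *
  exact r.update_rat hi hb

theorem loadMid {i j : ℕ} (hB : Fits n B) (hi : IsNatReg i) (hj : IsNatReg j)
    (hjn : σ.nat j < 2 * n)
    (hc : Runs n B c { σ with nat := Function.update σ.nat i (σ.mid (σ.nat j)) } T Q) :
    Runs n B (.seq (load i j 1) c) σ (T + 3) Q := by
  refine of_exec (fun M hM => ?_) hc
  obtain ⟨M', s, e, hs, r⟩ := exec_load hB hM (i := i) (f := 1)
    (by unfold IsNatReg at hi; omega) hj hjn (by omega)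
  refine ⟨_, s, e, hs, ?_⟩
  have hb := r.bounded.2 (12 + 3 * σ.nat j + 1)
  rw [r.mid] at *
  exact r.update_nat hi hb

theorem loadLst {i j : ℕ} (hB : Fits n B) (hi : IsRatReg i) (hj : IsNatReg j)
    (hjn : σ.nat j < 2 * n)
    (hc : Runs n B c { σ with rat := Function.update σ.rat i (σ.lst (σ.nat j)) } T Q) :
    Runs n B (.seq (load i j 2) c) σ (T + 3) Q := by
  refine of_exec (fun M hM => ?_) hc
  obtain ⟨M', s, e, hs, r⟩ := exec_load hB hM (i := i) (f := 2)
    (by unfold IsRatReg at hi; omega) hj hjn (by omega)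
  refine ⟨_, s, e, hs, ?_⟩
  have hb := r.bounded.2 (12 + 3 * σ.nat j + 2)
  rw [r.lst] at *
  exact r.update_rat hi hb

theorem storeFst {i j : ℕ} (hB : Fits n B) (hi : (Operand.cell i).Direct) (hj : IsNatReg j)
    (hjn : σ.nat j < 2 * n)
    (hc : Runs n B c
      { σ with fst := Function.update σ.fst (σ.nat j) (σ.eval (.cell i)) } T Q) :
    Runs n B (.seq (store j 0 i) c) σ (T + 3) Q := by
  refine of_exec (fun M hM => ?_) hc
  obtain ⟨M', s, e, hs, r, b⟩ := exec_store hB hM (f := 0) hi hj hjn (by omega)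
  exact ⟨_, s, e, hs, r.update_fst hjn b⟩

theorem storeMid {i j : ℕ} (hB : Fits n B) (hi : IsNatReg i) (hj : IsNatReg j)
    (hjn : σ.nat j < 2 * n)
    (hc : Runs n B c { σ with mid := Function.update σ.mid (σ.nat j) (σ.nat i) } T Q) :
    Runs n B (.seq (store j 1 i) c) σ (T + 3) Q := by
  refine of_exec (fun M hM => ?_) hc
  obtain ⟨M', s, e, hs, r, b⟩ := exec_store hB hM (f := 1) (.inl hi) hj hjn (by omega)
  have v : σ.eval (.cell i) = (σ.nat i : ℚ) := by simp [State.eval, hi]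
  rw [v] at e b
  exact ⟨_, s, e, hs, r.update_mid hjn b⟩

theorem storeLst {i j : ℕ} (hB : Fits n B) (hi : (Operand.cell i).Direct) (hj : IsNatReg j)
    (hjn : σ.nat j < 2 * n)
    (hc : Runs n B c
      { σ with lst := Function.update σ.lst (σ.nat j) (σ.eval (.cell i)) } T Q) :
    Runs n B (.seq (store j 2 i) c) σ (T + 3) Q := by
  refine of_exec (fun M hM => ?_) hc
  obtain ⟨M', s, e, hs, r, b⟩ := exec_store hB hM (f := 2) hi hj hjn (by omega)
  exact ⟨_, s, e, hs, r.update_lst hjn b⟩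

end Runs

/-! ### Insertion of an edge into a spanning tree

A spanning tree of `{0, …, n-1}` is given by parents `p u < u` and weights `w u`, for
`1 ≤ u < n`. It stands for the functions with the Gromov law that are bounded below by the
weights along the edges. -/

def Sat (n : ℕ) (p : ℕ → ℕ) (w : ℕ → ℚ) (S : ℕ → ℕ → ℝ) : Prop :=
  ∀ u, 1 ≤ u → u < n → (w u : ℝ) ≤ S u (p u)

/-- The weights are nonnegative and bounded by `r` at both ends of the edges. -/
structure Linked (n : ℕ) (r : ℕ → ℚ) (p : ℕ → ℕ) (w : ℕ → ℚ) : Prop where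
  lt : ∀ u, 1 ≤ u → u < n → p u < u
  nonneg : ∀ u, 1 ≤ u → u < n → 0 ≤ w u
  le_left : ∀ u, 1 ≤ u → u < n → w u ≤ r u
  le_right : ∀ u, 1 ≤ u → u < n → w u ≤ r (p u)

/-- The spanning tree together with the edge `uv` of weight `ω`, which is still to be inserted,
stands for the functions with the property `Φ`. -/
structure Pending (n : ℕ) (r : ℕ → ℚ) (Φ : (ℕ → ℕ → ℝ) → Prop) (p : ℕ → ℕ) (w : ℕ → ℚ)
    (u v : ℕ) (ω : ℚ) : Prop where
  linked : Linked n r p w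
  lt_left : u < n
  lt_right : v < n
  nonneg : 0 ≤ ω
  le_left : ω ≤ r u
  le_right : ω ≤ r v
  iff : ∀ S : ℕ → ℕ → ℝ, IsGromov S → (∀ i < n, (r i : ℝ) ≤ S i i) →
    ((Sat n p w S ∧ (ω : ℝ) ≤ S u v) ↔ Φ S)

namespace Pending

variable {n : ℕ} {r : ℕ → ℚ} {Φ : (ℕ → ℕ → ℝ) → Prop} {p : ℕ → ℕ} {w : ℕ → ℚ} {u v : ℕ} {ω : ℚ}

theorem symm (h : Pending n r Φ p w u v ω) : Pending n r Φ p w v u ω :=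
  ⟨h.linked, h.lt_right, h.lt_left, h.nonneg, h.le_right, h.le_left, fun S hS hd => by
    rw [hS.symm v u]; exact h.iff S hS hd⟩

/-- In the triangle `u`, `v`, `p u`, the tree already forces the side from `u` to `p u` to be at
least `ω`. By the Gromov law, the bound `ω` on either of the other sides implies it on the remaining
one. -/
theorem climb (h : Pending n r Φ p w u v ω) (hvu : v < u) (hω : ω ≤ w u) :
    Pending n r Φ p w (p u) v ω := by
  have h1 : 1 ≤ u := by omega
  have hlt := h.linked.lt u h1 h.lt_left
  refine ⟨h.linked, hlt.trans h.lt_left, h.lt_right, h.nonneg,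
    hω.trans (h.linked.le_right u h1 h.lt_left), h.le_right, fun S hS hd => ?_⟩
  rw [← h.iff S hS hd]
  have hω' : (ω : ℝ) ≤ w u := by exact_mod_cast hω
  refine and_congr_right fun hsat => ⟨fun hh => ?_, fun hh => ?_⟩
  · exact hS.trans (z := p u) (hω'.trans (hsat u h1 h.lt_left)) hh
  · exact hS.trans (z := u) (by rw [hS.symm]; exact hω'.trans (hsat u h1 h.lt_left)) hh

/-- The heavier edge `uv` takes the place of the edge from `u` to its parent. In the presence of
`uv`, the bound `w u` on the removed edge is equivalent to the same bound between `p u` and `v`,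
which becomes the pending edge. -/
theorem exchange (h : Pending n r Φ p w u v ω) (hvu : v < u) (hω : w u < ω) :
    Pending n r Φ (Function.update p u v) (Function.update w u ω) (p u) v (w u) := by
  have h1 : 1 ≤ u := by omega
  have hlt := h.linked.lt u h1 h.lt_left
  refine ⟨⟨fun i hi hin => ?_, fun i hi hin => ?_, fun i hi hin => ?_, fun i hi hin => ?_⟩,
    hlt.trans h.lt_left, h.lt_right, h.linked.nonneg u h1 h.lt_left,
    h.linked.le_right u h1 h.lt_left, hω.le.trans h.le_right, fun S hS hd => ?_⟩
  · by_cases hiu : i = u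
    · subst hiu; simpa using hvu
    · simpa [hiu] using h.linked.lt i hi hin
  · by_cases hiu : i = u
    · subst hiu; simpa using h.nonneg
    · simpa [hiu] using h.linked.nonneg i hi hin
  · by_cases hiu : i = u
    · subst hiu; simpa using h.le_left
    · simpa [hiu] using h.linked.le_left i hi hin
  · by_cases hiu : i = u
    · subst hiu; simpa using h.le_right
    · simpa [hiu] using h.linked.le_right i hi hin
  · rw [← h.iff S hS hd]
    have hω' : (w u : ℝ) ≤ ω := by exact_mod_cast hω.le
    constructor
    · rintro ⟨hsat, hpv⟩
      have huv : (ω : ℝ) ≤ S u v := by simpa using hsat u h1 h.lt_left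
      refine ⟨fun i hi hin => ?_, huv⟩
      by_cases hiu : i = u
      · subst hiu
        exact hS.trans (z := v) (hω'.trans huv) (by rw [hS.symm]; exact hpv)
      · simpa [hiu] using hsat i hi hin
    · rintro ⟨hsat, huv⟩
      refine ⟨fun i hi hin => ?_, ?_⟩
      · by_cases hiu : i = u
        · subst hiu; simpa using huv
        · simpa [hiu] using hsat i hi hin
      · exact hS.trans (z := u) (by rw [hS.symm]; exact hsat u h1 h.lt_left) (hω'.trans huv)

/-- A loop imposes nothing new: its weight is at most `r u`, which already bounds the diagonal from
below. -/
theorem done (h : Pending n r Φ p w u u ω) (S : ℕ → ℕ → ℝ) (hS : IsGromov S)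
    (hd : ∀ i < n, (r i : ℝ) ≤ S i i) : Sat n p w S ↔ Φ S := by
  rw [← h.iff S hS hd]
  have : (ω : ℝ) ≤ r u := by exact_mod_cast h.le_left
  exact ⟨fun hh => ⟨hh, this.trans (hd u h.lt_left)⟩, fun hh => hh.1⟩

end Pending

/-! ### Construction of the output tree

The tree has the nodes `0, …, 2n-1`, of which `2n-1` is the root. For `1 ≤ u < n`, the node `u`
is attached at height `w u` to the path from the node `p u` to the root, by means of the new node
`2n-1-u`. -/

/-- The nodes present before `u` is attached. -/
def Present (n u k : ℕ) : Prop := k < u ∨ 2 * n - u ≤ k ∧ k < 2 * n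

/-- The element of `{0, …, n-1}` whose attachment brought in the node `k`. -/
def owner (n k : ℕ) : ℕ := if k < n then k else 2 * n - 1 - k

/-- `K` is bounded below by the heights along the edges of the tree. -/
def TreeSat (n u : ℕ) (par : ℕ → ℕ) (h : ℕ → ℚ) (K : ℕ → ℕ → ℝ) : Prop :=
  ∀ k, Present n u k → k ≠ 2 * n - 1 → (h (par k) : ℝ) ≤ K k (par k)

/-- The tree with the parents `par` and the heights `h` that is present before `u` is attached. -/
structure Built (n : ℕ) (r : ℕ → ℚ) (p : ℕ → ℕ) (w : ℕ → ℚ) (u : ℕ) (par : ℕ → ℕ) (h : ℕ → ℚ)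
    (rank : ℕ → ℕ) : Prop where
  present : ∀ k, Present n u k → k ≠ 2 * n - 1 → Present n u (par k)
  rank_lt : ∀ k, Present n u k → k ≠ 2 * n - 1 → rank (par k) < rank k
  rank_le : ∀ k, Present n u k → rank k ≤ u
  mono : ∀ k, Present n u k → k ≠ 2 * n - 1 → h (par k) ≤ h k
  leaf : ∀ k < n, h k = r k
  root : h (2 * n - 1) = 0
  -- This makes the ancestor heights of the tree satisfy the constraints of the spanning tree;
  -- `upper` makes them least, by pulling each admissible function back along `owner`.
  lower : ∀ K : ℕ → ℕ → ℝ, IsGromov K → TreeSat n u par h K →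
    ∀ i, 1 ≤ i → i < u → (w i : ℝ) ≤ K i (p i)
  upper : ∀ S : ℕ → ℕ → ℝ, IsGromov S → (∀ i < n, (r i : ℝ) ≤ S i i) → Sat n p w S →
    TreeSat n u par h (fun x y => S (owner n x) (owner n y)) ∧
    ∀ k, Present n u k → (h k : ℝ) ≤ S (owner n k) (owner n k)

/-- The node `x` has been reached from the node `p u` on the search for the place where `u` is
to be attached. -/
structure Reached (n : ℕ) (r : ℕ → ℚ) (p : ℕ → ℕ) (w : ℕ → ℚ) (u : ℕ) (par : ℕ → ℕ) (h : ℕ → ℚ)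
    (x : ℕ) : Prop where
  present : Present n u x
  ne_root : x ≠ 2 * n - 1
  le : w u ≤ h x
  -- The start `x = p u` is a separate case because `TreeSat` need not give the bound `w u` on the
  -- diagonal of `K`.
  lower : ∀ K : ℕ → ℕ → ℝ, IsGromov K → TreeSat n u par h K → x = p u ∨ (w u : ℝ) ≤ K (p u) x
  upper : ∀ S : ℕ → ℕ → ℝ, IsGromov S → (∀ i < n, (r i : ℝ) ≤ S i i) → Sat n p w S →
    (w u : ℝ) ≤ S (p u) (owner n x)

section

variable {n : ℕ} {r : ℕ → ℚ} {p : ℕ → ℕ} {w : ℕ → ℚ} {u : ℕ} {par : ℕ → ℕ} {h : ℕ → ℚ}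
  {rank : ℕ → ℕ} {x : ℕ}

/-- At first there are only the element `0` and the root, both at height zero and both owned by `0`.
-/
theorem Built.init (hn : 1 ≤ n) (hr0 : r 0 = 0) (hpar : par 0 = 2 * n - 1)
    (hleaf : ∀ k < n, h k = r k) (hroot : h (2 * n - 1) = 0) :
    Built n r p w 1 par h (fun k => if k = 0 then 1 else 0) := by
  have key : ∀ k, Present n 1 k → k = 0 ∨ k = 2 * n - 1 := by
    intro k hk; unfold Present at hk; omega
  have hne : 2 * n - 1 ≠ 0 := by omega
  have hown : owner n (2 * n - 1) = 0 := by unfold owner; split_ifs <;> omega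
  have hown0 : owner n 0 = 0 := by unfold owner; split_ifs <;> omega
  refine ⟨fun k hk hkr => ?_, fun k hk hkr => ?_, fun k hk => ?_, fun k hk hkr => ?_, hleaf, hroot,
    fun K _ _ i hi hi' => by omega, fun S hS hd _ => ⟨fun k hk hkr => ?_, fun k hk => ?_⟩⟩
  · rw [(key k hk).resolve_right hkr, hpar]; unfold Present; omega
  · rw [(key k hk).resolve_right hkr, hpar]; simp [hne]
  · split_ifs <;> omega
  · rw [(key k hk).resolve_right hkr, hpar, hroot, hleaf 0 (by omega), hr0]
  · have := hd 0 (by omega)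
    beta_reduce
    rw [(key k hk).resolve_right hkr, hpar, hroot, hown, hown0]
    rwa [hr0] at this
  · have := hd 0 (by omega)
    rw [hr0] at this
    rcases key k hk with rfl | rfl
    · rw [hown0, hleaf 0 (by omega), hr0]; exact this
    · rw [hown, hroot]; exact this

/-- Clipping from above pays off here: `w u ≤ r (p u)`, so the search for height `w u` can begin at
the leaf `p u`. -/
theorem Reached.init (hl : Linked n r p w) (hb : Built n r p w u par h rank) (hu : 1 ≤ u)
    (hun : u < n) : Reached n r p w u par h (p u) := by
  have hlt := hl.lt u hu hun
  refine ⟨.inl hlt, by omega, ?_, fun _ _ _ => .inl rfl, fun S hS hd _ => ?_⟩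
  · rw [hb.leaf _ (by omega)]; exact hl.le_right u hu hun
  · have : owner n (p u) = p u := by unfold owner; rw [if_pos (by omega)]
    rw [this]
    have h1 : (w u : ℝ) ≤ r (p u) := by exact_mod_cast hl.le_right u hu hun
    exact h1.trans (hd _ (by omega))

/-- The climb cannot arrive at the root: the root has height zero, weights are nonnegative, and the
test is strict. -/
theorem Reached.step (hl : Linked n r p w) (hb : Built n r p w u par h rank) (hu : 1 ≤ u)
    (hun : u < n) (hx : Reached n r p w u par h x) (hlt : w u < h (par x)) :
    Reached n r p w u par h (par x) := by
  have hlt' : (w u : ℝ) ≤ h (par x) := by exact_mod_cast hlt.le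
  refine ⟨hb.present x hx.present hx.ne_root, fun he => ?_, hlt.le, fun K hK hs => .inr ?_,
    fun S hS hd hs => ?_⟩
  · rw [he, hb.root] at hlt
    exact absurd (hl.nonneg u hu hun) (not_le.mpr hlt)
  · have h2 := hlt'.trans (hs x hx.present hx.ne_root)
    rcases hx.lower K hK hs with h1 | h1
    · rw [← h1]; exact h2
    · exact hK.trans h1 h2
  · exact hS.trans (hx.upper S hS hd hs)
      (hlt'.trans ((hb.upper S hS hd hs).1 x hx.present hx.ne_root))

/-- The attachment of `u` at the edge from `x` to its parent. -/
theorem Built.attach (hl : Linked n r p w) (hb : Built n r p w u par h rank) (hu : 1 ≤ u)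
    (hun : u < n) (hx : Reached n r p w u par h x) (hle : h (par x) ≤ w u) :
    ∃ rank', Built n r p w (u + 1)
      (Function.update (Function.update (Function.update par (2 * n - 1 - u) (par x)) x
        (2 * n - 1 - u)) u (2 * n - 1 - u))
      (Function.update h (2 * n - 1 - u) (w u)) rank' := by
  obtain ⟨a, ha⟩ : ∃ a, a = 2 * n - 1 - u := ⟨_, rfl⟩
  obtain ⟨y, hy⟩ : ∃ y, y = par x := ⟨_, rfl⟩
  rw [← ha, ← hy]
  rw [← hy] at hle
  have hyp : Present n u y := hy ▸ hb.present x hx.present hx.ne_root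
  have hyx : rank y < rank x := hy ▸ hb.rank_lt x hx.present hx.ne_root
  have hleR : (h y : ℝ) ≤ w u := by exact_mod_cast hle
  have hna : ¬ Present n u a := by unfold Present; omega
  have hnu : ¬ Present n u u := by unfold Present; omega
  have hxa : x ≠ a := fun he => hna (he ▸ hx.present)
  have hxu : x ≠ u := fun he => hnu (he ▸ hx.present)
  have hau : a ≠ u := by omega
  have har : a ≠ 2 * n - 1 := by omega
  have hur : u ≠ 2 * n - 1 := by omega
  have oa : owner n a = u := by unfold owner; rw [if_neg (by omega)]; omega
  have ou : owner n u = u := by unfold owner; rw [if_pos hun]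
  have old : ∀ k, Present n u k → Present n (u + 1) k := fun k hk => by
    unfold Present at *; omega
  have new : ∀ k, Present n (u + 1) k → Present n u k ∨ k = u ∨ k = a := fun k hk => by
    unfold Present at *; omega
  set par' := Function.update (Function.update (Function.update par a y) x a) u a with hpar'
  set h' := Function.update h a (w u) with hh'
  have pa : par' a = y := by simp [hpar', hau, hxa.symm]
  have px : par' x = a := by simp [hpar', hxu]
  have pu : par' u = a := by simp [hpar']
  have po : ∀ k, Present n u k → k ≠ x → par' k = par k := fun k hk hkx => by
    have h1 : k ≠ u := fun he => hnu (he ▸ hk)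
    have h2 : k ≠ a := fun he => hna (he ▸ hk)
    simp [hpar', h1, h2, hkx]
  have ha' : h' a = w u := by simp [hh']
  have ho' : ∀ k, k ≠ a → h' k = h k := fun k hk => by simp [hh', hk]
  have hop : ∀ k, Present n u k → h' k = h k := fun k hk =>
    ho' k fun he => hna (he ▸ hk)
  have hpp : ∀ k, Present n u k → k ≠ 2 * n - 1 → h' (par k) = h (par k) := fun k hk hkr =>
    hop _ (hb.present k hk hkr)
  -- Ranks from `rank x` on are raised by one to make room for the new node just above its child
  -- `x`.
  let rank' : ℕ → ℕ := fun k => if k = a then rank x else if k = u then rank x + 1 else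
    if rank x ≤ rank k then rank k + 1 else rank k
  have ra : rank' a = rank x := by simp [rank']
  have ru : rank' u = rank x + 1 := by simp [rank', hau.symm]
  have ro : ∀ k, Present n u k →
      rank' k = if rank x ≤ rank k then rank k + 1 else rank k := fun k hk => by
    have h1 : k ≠ u := fun he => hnu (he ▸ hk)
    have h2 : k ≠ a := fun he => hna (he ▸ hk)
    simp [rank', h1, h2]
  have rx : rank' x = rank x + 1 := by rw [ro x hx.present]; simp
  have ry : rank' y = rank y := by rw [ro y hyp, if_neg (by omega)]
  have byNode : ∀ P : ℕ → Prop, (P u) → (P a) → (P x) →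
      (∀ k, Present n u k → k ≠ 2 * n - 1 → k ≠ x → P k) →
      ∀ k, Present n (u + 1) k → k ≠ 2 * n - 1 → P k := by
    intro P h1 h2 h3 h4 k hk hkr
    rcases new k hk with hk | rfl | rfl
    · by_cases hkx : k = x
      · exact hkx ▸ h3
      · exact h4 k hk hkr hkx
    · exact h1
    · exact h2
  have hpa : Present n (u + 1) a := by unfold Present; omega
  refine ⟨rank', ⟨?_, ?_, ?_, ?_, fun k hk => ?_, ?_, ?_, ?_⟩⟩
  · refine byNode _ (by rwa [pu]) (by rw [pa]; exact old y hyp) (by rwa [px]) fun k hk hkr hkx => ?_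
    rw [po k hk hkx]; exact old _ (hb.present k hk hkr)
  · refine byNode _ (by rw [pu, ra, ru]; omega) (by rw [pa, ra, ry]; exact hyx)
      (by rw [px, ra, rx]; omega) fun k hk hkr hkx => ?_
    have := hb.rank_lt k hk hkr
    rw [po k hk hkx, ro k hk, ro _ (hb.present k hk hkr)]
    split_ifs <;> omega
  · intro k hk
    have hrx := hb.rank_le x hx.present
    rcases new k hk with hk | rfl | rfl
    · have := hb.rank_le k hk
      rw [ro k hk]; split_ifs <;> omega
    · rw [ru]; omega
    · rw [ra]; omega
  · refine byNode _ ?_ (by rw [pa, ha', hop y hyp]; exact hle)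
      (by rw [px, ha', ho' x hxa]; exact hx.le) fun k hk hkr hkx => ?_
    · rw [pu, ha', ho' u hau.symm, hb.leaf u hun]; exact hl.le_left u hu hun
    · rw [po k hk hkx, hpp k hk hkr, hop k hk]; exact hb.mono k hk hkr
  · rw [ho' k (by omega)]; exact hb.leaf k hk
  · rw [ho' _ har.symm]; exact hb.root
  · intro K hK hs
    have kx : (w u : ℝ) ≤ K x a := by
      have := hs x (old x hx.present) hx.ne_root; rwa [px, ha'] at this
    have ku : (w u : ℝ) ≤ K u a := by
      have := hs u (by unfold Present; omega) hur; rwa [pu, ha'] at this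
    have ka : (h y : ℝ) ≤ K a y := by
      have := hs a hpa har; rwa [pa, hop y hyp] at this
    -- The edge from `x` to `y` has been subdivided at `a`; since `h y ≤ w u`, the bounds on its two
    -- halves give back the bound on the whole.
    have hs' : TreeSat n u par h K := by
      intro k hk hkr
      by_cases hkx : k = x
      · rw [hkx, ← hy]; exact hK.trans (hleR.trans kx) ka
      · have := hs k (old k hk) hkr
        rwa [po k hk hkx, hpp k hk hkr] at this
    intro i hi hiu
    by_cases hi' : i = u
    -- The chain from `u` through `a` and `x` to the spanning-tree parent of `u` is bounded below by
    -- the weight of `u` at every link.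
    · subst hi'
      refine hK.trans ku ?_
      rw [hK.symm]
      rcases hx.lower K hK hs' with h1 | h1
      · rw [← h1]; exact kx
      · exact hK.trans h1 kx
    · exact hb.lower K hK hs' i hi (by omega)
  · intro S hS hd hs
    obtain ⟨h1, h2⟩ := hb.upper S hS hd hs
    have hup := hs u hu hun
    have hux : (w u : ℝ) ≤ S u (owner n x) := hS.trans hup (hx.upper S hS hd hs)
    have huu : (w u : ℝ) ≤ S u u := hS.trans hup (by rw [hS.symm]; exact hup)
    have hxy : (h y : ℝ) ≤ S (owner n x) (owner n y) := by
      have := h1 x hx.present hx.ne_root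
      rwa [← hy] at this
    refine ⟨byNode _ ?_ ?_ ?_ fun k hk hkr hkx => ?_, fun k hk => ?_⟩
    · beta_reduce; rw [pu, ha', oa, ou]; exact huu
    · beta_reduce; rw [pa, hop y hyp, oa]; exact hS.trans (hleR.trans hux) hxy
    · beta_reduce; rw [px, ha', oa, hS.symm]; exact hux
    · rw [po k hk hkx, hpp k hk hkr]; exact h1 k hk hkr
    · rcases new k hk with hk | rfl | rfl
      · rw [hop k hk]; exact h2 k hk
      · rw [ho' _ hau.symm, ou, hb.leaf _ hun]; exact hd _ hun
      · rw [ha', oa]; exact huu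

end

/-! ### The programs -/

/-- Copies the register `j` to the register `i`. -/
def copy (i j : ℕ) : Cmd := .assign (.cell i) .add (.cell j) (.lit 0)

/-- Puts the larger of the registers `0` and `1` first. -/
def sortEnds : Cmd :=
  .ite (.cell 0) (.cell 1) (.seq (copy 6 0) <| .seq (copy 0 1) <| .seq (copy 1 6) .skip) .skip

def exchangeStep : Cmd :=
  .ite (.cell 9) (.cell 2) (.seq (store 0 1 1) <| .seq (store 0 2 2) <| .seq (copy 2 9) .skip) .skip

def insertStep : Cmd :=
  .seq (load 5 0 1) <| .seq (load 9 0 2) <| .seq exchangeStep <| .seq (copy 0 5) <| sortEnds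

/-- Inserts the edge between the registers `0` and `1`, with its weight in register `2`, into the
spanning tree. -/
def insertEdge : Cmd :=
  .seq sortEnds <| .while (.cell 1) (.cell 0) insertStep

/-- Replaces the register `j` by the minimum of the registers `i` and `j`. -/
def clip (i j : ℕ) : Cmd := .ite (.cell i) (.cell j) (.seq (copy j i) .skip) .skip

/-- Replaces the distance in register `2` by the Gromov product with respect to `0`, clipped to
its natural range. -/
def gromovProduct : Cmd :=
  .seq (load 9 0 0) <| .seq (load 10 1 0) <|
  .seq (.assign (.cell 11) .add (.cell 9) (.cell 10)) <|
  .seq (.assign (.cell 2) .sub (.cell 11) (.cell 2)) <|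
  .seq (.assign (.cell 2) .div (.cell 2) (.lit 2)) <|
  .seq (.ite (.cell 2) (.lit 0) (.seq (.assign (.cell 2) .add (.lit 0) (.lit 0)) .skip) .skip) <|
  .seq (clip 9 2) <| clip 10 2

/-- Records the distances from `0`. -/
def recordBody : Cmd :=
  .ite (.cell 0) (.lit 1) (.seq (store 1 0 2) .skip)
    (.ite (.cell 1) (.lit 1) (.seq (store 0 0 2) .skip) .skip)

def climbStep : Cmd :=
  .seq (copy 5 6) <| .seq (load 6 5 1) <| .seq (load 9 6 0) .skip

def attachStep : Cmd :=
  .seq (load 5 0 1) <| .seq (load 2 0 2) <| .seq (load 6 5 1) <| .seq (load 9 6 0) <|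
  .seq (.while (.cell 2) (.cell 9) climbStep) <|
  .seq (.assign (.cell 1) .sub (.cell 1) (.lit 1)) <| .seq (store 1 0 2) <| .seq (store 1 1 6) <|
  .seq (store 5 1 1) <| .seq (store 0 1 1) <|
  .seq (.assign (.cell 0) .add (.cell 0) (.lit 1)) .skip

def lengthStep : Cmd :=
  .seq (load 6 0 1) <| .seq (load 9 0 0) <| .seq (load 10 6 0) <|
  .seq (.assign (.cell 9) .sub (.cell 9) (.cell 10)) <| .seq (store 0 2 9) <|
  .seq (.assign (.cell 0) .add (.cell 0) (.lit 1)) .skip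

def labelStep : Cmd :=
  .seq (store 0 0 0) <| .seq (.assign (.cell 0) .add (.cell 0) (.lit 1)) .skip

def setLit (i : ℕ) (q : ℚ) : Cmd := .assign (.cell i) .add (.lit q) (.lit 0)

/-- Converts the spanning tree into the output tree. -/
def buildTree : Cmd :=
  .seq (.assign (.cell 7) .add (.cell 4) (.cell 4)) <|
  .seq (.assign (.cell 7) .sub (.cell 7) (.lit 1)) <| .seq (setLit 0 0) <| .seq (store 0 1 7) <|
  .seq (copy 1 7) <| .seq (setLit 0 1) <| .seq (.while (.cell 0) (.cell 4) attachStep) <|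
  .seq (setLit 0 0) <| .seq (.while (.cell 0) (.cell 7) lengthStep) <| .seq (setLit 0 0) <|
  .seq (.while (.cell 0) (.cell 7) labelStep) <|
  .seq (.assign (.cell 0) .add (.cell 7) (.lit 1)) <| .seq (setLit 1 12) .skip

/-- The two-pass algorithm. -/
def treeAlg : StreamAlg where
  init := .seq (copy 4 0) .skip
  passes := [(recordBody, .skip), (.seq gromovProduct insertEdge, buildTree)]

/-! ### Their correctness -/

theorem Runs.copyNat {n B : ℕ} {σ : State} {T : ℕ} {Q : State → Prop} {c : Cmd} {i j : ℕ}
    (hi : IsNatReg i) (hj : IsNatReg j)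
    (hc : Runs n B c { σ with nat := Function.update σ.nat i (σ.nat j) } T Q) :
    Runs n B (.seq (copy i j) c) σ (T + 1) Q := by
  refine of_exec (fun M hM => ?_) hc
  have v : BinOp.add.eval ((Operand.cell j).eval M) ((Operand.lit 0).eval M) = σ.nat j := by
    simp [BinOp.eval, Operand.eval, hM.nat j hj]
  have b : bitLength (σ.nat j : ℚ) ≤ B := by rw [← hM.nat j hj]; exact hM.bounded.2 j
  obtain ⟨s, e, hs, -⟩ := exec_assign hM.bounded (.cell i) .add (.cell j) (.lit 0)
    (by unfold IsNatReg at hi; simp only [Dest.addr, cells]; omega) (by rw [v]; exact b)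
  rw [v] at e
  exact ⟨_, s, e, hs, hM.update_nat hi b⟩

/-- An edge is being inserted; the tree together with the edge stands for `Φ`. -/
structure Inserting (n b : ℕ) (r : ℕ → ℚ) (Φ : (ℕ → ℕ → ℝ) → Prop) (σ : State) : Prop where
  order : σ.nat 4 = n
  fst : σ.fst = r
  pending : Pending n r Φ σ.mid σ.lst (σ.nat 0) (σ.nat 1) (σ.rat 2)
  bits_lst : ∀ j, bitLength (σ.lst j) ≤ b
  bits_rat : bitLength (σ.rat 2) ≤ b

section

variable {n b B : ℕ} {r : ℕ → ℚ} {Φ : (ℕ → ℕ → ℝ) → Prop} {σ : State}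

theorem runs_sortEnds (h : Inserting n b r Φ σ) :
    Runs n B sortEnds σ 5 fun σ' => Inserting n b r Φ σ' ∧ σ'.nat 1 ≤ σ'.nat 0 ∧
      σ'.nat 0 + σ'.nat 1 = σ.nat 0 + σ.nat 1 := by
  refine Runs.ite (by decide) (by decide) (fun hlt => ?_) (fun hlt => ?_)
  · refine Runs.copyNat (by decide) (by decide) <| Runs.copyNat (by decide) (by decide) <|
      Runs.copyNat (by decide) (by decide) <| Runs.skip ?_
    simp [State.eval, IsNatReg] at hlt
    refine ⟨⟨by simpa using h.order, h.fst, by simpa using h.pending.symm, h.bits_lst,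
      h.bits_rat⟩, ?_, ?_⟩
    · simpa using hlt.le
    · simp [add_comm]
  · refine Runs.skip ⟨h, ?_, rfl⟩
    simpa [State.eval, IsNatReg] using hlt

/-- With or without an exchange, the larger end is replaced by its old parent, so the sum of the
ends drops. The parent is kept in register `5`, since the exchange overwrites it in the table. -/
theorem runs_insertStep (hB : Fits n B) (h : Inserting n b r Φ σ) (hlt : σ.nat 1 < σ.nat 0) :
    Runs n B insertStep σ 23 fun σ' => Inserting n b r Φ σ' ∧ σ'.nat 1 ≤ σ'.nat 0 ∧
      σ'.nat 0 + σ'.nat 1 < σ.nat 0 + σ.nat 1 := by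
  have h0 := h.pending.lt_left
  have hp := h.pending.linked.lt _ (by omega) h0
  refine Runs.loadMid hB (by decide) (by decide) (by omega) <|
    Runs.loadLst hB (by decide) (by decide) (by simp; omega) ?_
  refine Runs.seq (T₁ := 9) (T₂ := 8) (R := fun τ => τ.nat 4 = n ∧ τ.fst = r ∧
    Pending n r Φ τ.mid τ.lst (τ.nat 5) (τ.nat 1) (τ.rat 2) ∧ (∀ j, bitLength (τ.lst j) ≤ b) ∧
    bitLength (τ.rat 2) ≤ b ∧ τ.nat 5 = σ.mid (σ.nat 0) ∧ τ.nat 1 = σ.nat 1) ?_ ?_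
  · refine Runs.ite (by decide) (by decide) (fun hw => ?_) (fun hw => ?_)
    · refine Runs.storeMid hB (by decide) (by decide) (by simp; omega) <|
        Runs.storeLst hB (by decide) (by decide) (by simp; omega) <|
        Runs.copyRat (by decide) (by decide) <| Runs.skip ?_
      simp [State.eval, IsNatReg] at hw
      simp [State.eval, IsNatReg]
      refine ⟨h.order, h.fst, h.pending.exchange hlt hw, fun j => ?_, h.bits_lst _⟩
      rw [Function.update_apply]
      split_ifs
      · exact h.bits_rat
      · exact h.bits_lst j
    · refine Runs.skip ?_
      simp [State.eval, IsNatReg] at hw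
      simp
      exact ⟨h.order, h.fst, h.pending.climb hlt hw, h.bits_lst, h.bits_rat⟩
  · rintro τ ⟨h1, h2, h3, h4, h5, h6, h7⟩
    refine Runs.copyNat (T := 7) (by decide) (by decide) ?_
    have hi : Inserting n b r Φ { τ with nat := Function.update τ.nat 0 (τ.nat 5) } :=
      ⟨by simpa using h1, h2, by simpa using h3, h4, h5⟩
    refine (runs_sortEnds hi).mono (by norm_num) ?_
    rintro τ' ⟨i1, i2, i3⟩
    refine ⟨i1, i2, ?_⟩
    rw [i3]
    simp [h6, h7]
    omega

theorem runs_insertEdge (hB : Fits n B) (h : Inserting n b r Φ σ) :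
    Runs n B insertEdge σ (5 + (24 * (2 * n) + 1)) fun σ' =>
      σ'.nat 4 = n ∧ σ'.fst = r ∧ Linked n r σ'.mid σ'.lst ∧
      (∀ S : ℕ → ℕ → ℝ, IsGromov S → (∀ i < n, (r i : ℝ) ≤ S i i) →
        (Sat n σ'.mid σ'.lst S ↔ Φ S)) ∧
      ∀ j, bitLength (σ'.lst j) ≤ b := by
  refine Runs.seq (runs_sortEnds h) fun τ hτ => ?_
  refine Runs.loop (T := 23) (by decide) (by decide)
    (fun k σ => Inserting n b r Φ σ ∧ σ.nat 1 ≤ σ.nat 0 ∧ σ.nat 0 + σ.nat 1 ≤ k)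
    (fun k σ hI hc => ?_) (fun k σ hI hc => ?_) (2 * n) ?_
  · simp [State.eval, IsNatReg] at hc
    refine (runs_insertStep hB hI.1 hc).mono le_rfl ?_
    rintro σ' ⟨h1, h2, h3⟩
    exact ⟨_, h3.trans_le hI.2.2, h1, h2, le_rfl⟩
  · simp [State.eval, IsNatReg] at hc
    obtain ⟨h1, h2, -⟩ := hI
    have he : σ.nat 1 = σ.nat 0 := le_antisymm h2 hc
    have h3 := h1.pending
    rw [he] at h3
    exact ⟨h1.order, h1.fst, h3.linked, h3.done, h1.bits_lst⟩
  · have := hτ.1.pending.lt_left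
    have := hτ.1.pending.lt_right
    exact ⟨hτ.1, hτ.2.1, by omega⟩

/-- The Gromov product for distances `x` and `y` from the base point and `d` from each other,
clipped to its natural range. -/
def clipped (x y d : ℚ) : ℚ := min y (min x (max 0 ((x + y - d) / 2)))

theorem runs_clip {i j : ℕ} (hi : IsRatReg i) (hj : IsRatReg j) :
    Runs n B (clip i j) σ 3 fun σ' =>
      σ' = { σ with rat := Function.update σ.rat j (min (σ.rat i) (σ.rat j)) } := by
  have hi' : ¬ IsNatReg i := by unfold IsRatReg at hi; unfold IsNatReg; omega
  have hj' : ¬ IsNatReg j := by unfold IsRatReg at hj; unfold IsNatReg; omega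
  refine Runs.ite (.inr hi) (.inr hj) (fun hlt => ?_) (fun hlt => ?_)
  · simp [State.eval, hi', hj'] at hlt
    refine Runs.copyRat hj hi <| Runs.skip ?_
    rw [min_eq_left hlt.le]
  · simp [State.eval, hi', hj'] at hlt
    refine Runs.skip ?_
    rw [min_eq_right hlt, Function.update_eq_self]

/-- The sum has at most `4 * b₀` bits, the difference `10 * b₀`, and halving adds two; clipping only
selects among numbers already bounded. -/
theorem runs_gromovProduct (hB : Fits n B) {b₀ : ℕ} (hb₀ : 2 ≤ b₀) (hbB : 10 * b₀ + 2 ≤ B)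
    (h0 : σ.nat 0 < n) (h1 : σ.nat 1 < n) (hf : ∀ j, bitLength (σ.fst j) ≤ b₀)
    (hd : bitLength (σ.rat 2) ≤ b₀) :
    Runs n B gromovProduct σ 18 fun σ' =>
      σ'.nat = σ.nat ∧ σ'.fst = σ.fst ∧ σ'.mid = σ.mid ∧ σ'.lst = σ.lst ∧
      σ'.rat 2 = clipped (σ.fst (σ.nat 0)) (σ.fst (σ.nat 1)) (σ.rat 2) ∧
      bitLength (σ'.rat 2) ≤ 10 * b₀ + 2 := by
  set x := σ.fst (σ.nat 0) with hx
  set y := σ.fst (σ.nat 1) with hy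
  set d := σ.rat 2 with hd'
  have b1 : bitLength (x + y) ≤ 4 * b₀ := by
    have h2 := bitLength_add_le x y
    have h3 : bitLength x ≤ b₀ := hf (σ.nat 0)
    have h4 : bitLength y ≤ b₀ := hf (σ.nat 1)
    omega
  have b2 : bitLength (x + y - d) ≤ 10 * b₀ := by
    have := bitLength_sub_le (x + y) d
    omega
  have b3 : bitLength ((x + y - d) / 2) ≤ 10 * b₀ + 2 := by
    have := bitLength_div_two_le (x + y - d)
    omega
  have b0 : bitLength (0 : ℚ) ≤ 2 := by decide
  refine Runs.loadFst hB (by decide) (by decide) (by omega) <|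
    Runs.loadFst hB (by decide) (by decide) (by dsimp only; omega) <|
    Runs.setRat (by decide) (by decide) (by decide) ?_ <|
    Runs.setRat (by decide) (by decide) (by decide) ?_ <|
    Runs.setRat (by decide) (by decide) (by decide) ?_ ?_
  · simp [State.eval, IsNatReg, BinOp.eval, ← hx, ← hy]; omega
  · simp [State.eval, IsNatReg, BinOp.eval, ← hx, ← hy, ← hd']; omega
  · simp [State.eval, IsNatReg, BinOp.eval, ← hx, ← hy, ← hd']; omega
  refine Runs.seq (T₁ := 3) (T₂ := 6) (R := fun τ => τ.nat = σ.nat ∧ τ.fst = σ.fst ∧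
    τ.mid = σ.mid ∧ τ.lst = σ.lst ∧ τ.rat 9 = x ∧ τ.rat 10 = y ∧
    τ.rat 2 = max 0 ((x + y - d) / 2)) ?_ ?_
  · refine Runs.ite (by decide) (by decide) (fun hlt => ?_) (fun hlt => ?_)
    · simp [State.eval, IsNatReg, BinOp.eval, ← hx, ← hy, ← hd'] at hlt
      refine Runs.setRat (by decide) (by decide) (by decide) ?_ <| Runs.skip ?_
      · simp [State.eval, BinOp.eval]; omega
      · simp [State.eval, BinOp.eval, ← hx, ← hy]
        exact hlt.le
    · simp [State.eval, IsNatReg, BinOp.eval, ← hx, ← hy, ← hd'] at hlt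
      refine Runs.skip ?_
      simp [State.eval, IsNatReg, BinOp.eval, ← hx, ← hy, ← hd']
      linarith
  · rintro τ ⟨t1, t2, t3, t4, t5, t6, t7⟩
    refine Runs.seq (T₁ := 3) (T₂ := 3) (runs_clip (by decide) (by decide)) ?_
    rintro _ rfl
    refine (runs_clip (by decide) (by decide)).mono le_rfl ?_
    rintro _ rfl
    simp only [t1, t2, t3, t4, true_and]
    have e : min y (min x (max 0 ((x + y - d) / 2))) = clipped x y d := rfl
    simp [t5, t6, t7, e]
    have hbx : bitLength x ≤ 10 * b₀ + 2 := (hf _).trans (by omega)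
    have hby : bitLength y ≤ 10 * b₀ + 2 := (hf _).trans (by omega)
    unfold clipped
    rcases min_choice y (min x (max 0 ((x + y - d) / 2))) with e | e <;> rw [e]
    · exact hby
    rcases min_choice x (max 0 ((x + y - d) / 2)) with e | e <;> rw [e]
    · exact hbx
    rcases max_choice 0 ((x + y - d) / 2) with e | e <;> rw [e]
    · omega
    · exact b3

end

/-! ### Correctness of the construction of the output tree -/

/-- `u` is the next element to be attached. -/
structure Attaching (n b : ℕ) (r : ℕ → ℚ) (p : ℕ → ℕ) (w : ℕ → ℚ) (u : ℕ) (σ : State) :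
    Prop where
  nat_zero : σ.nat 0 = u
  nat_one : σ.nat 1 = 2 * n - u
  nat_four : σ.nat 4 = n
  nat_seven : σ.nat 7 = 2 * n - 1
  one_le : 1 ≤ u
  le : u ≤ n
  built : ∃ rank, Built n r p w u σ.mid σ.fst rank
  mid : ∀ i, u ≤ i → i < n → σ.mid i = p i
  lst : σ.lst = w
  bits_fst : ∀ j, bitLength (σ.fst j) ≤ b
  bits_lst : ∀ j, bitLength (σ.lst j) ≤ b

section

variable {n b B : ℕ} {r : ℕ → ℚ} {p : ℕ → ℕ} {w : ℕ → ℚ} {u : ℕ} {σ : State}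

theorem Present.lt_two_mul {k : ℕ} (h : Present n u k) (hu : u ≤ n) : k < 2 * n := by
  unfold Present at h; omega

/-- The column `mid` holds two trees at once: parents in the output tree at the nodes present, and
parents in the spanning tree at the elements still to come. Each climb lowers the rank, which is at
most `u ≤ n`, so `n` rounds suffice. -/
theorem runs_attachStep (hB : Fits n B) (hl : Linked n r p w)
    (h : Attaching n b r p w u σ) (hun : u < n) :
    Runs n B attachStep σ (38 + 9 * n) fun σ' => Attaching n b r p w (u + 1) σ' := by
  obtain ⟨rank, hb⟩ := h.built
  have hu := h.one_le
  have hu2 : u ≤ n := h.le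
  have hmu : σ.mid u = p u := h.mid u le_rfl hun
  have hr0 := Reached.init hl hb hu hun
  have hp2 : p u < 2 * n := hr0.present.lt_two_mul hu2
  have hpar : ∀ k, Present n u k → k ≠ 2 * n - 1 → σ.mid k < 2 * n := fun k hk hkr =>
    (hb.present k hk hkr).lt_two_mul hu2
  have e1 : 38 + 9 * n = (((25 + 9 * n + 1) + 3) + 3 + 3) + 3 := by ring
  rw [e1]
  refine Runs.loadMid hB (by decide) (by decide) (by rw [h.nat_zero]; omega) <|
    Runs.loadLst hB (by decide) (by decide) (by simp [h.nat_zero]; omega) <|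
    Runs.loadMid hB (by decide) (by decide) (by simp [h.nat_zero, hmu]; omega) <|
    Runs.loadFst hB (by decide) (by decide)
      (by simp [h.nat_zero, hmu]; exact hpar _ hr0.present hr0.ne_root) ?_
  have e2 : 25 + 9 * n + 1 = ((8 + 1) * n + 1) + 25 := by ring
  rw [e2]
  refine Runs.seq (T₁ := (8 + 1) * n + 1) (T₂ := 25) (R := fun τ => τ.nat 0 = u ∧
    τ.nat 1 = 2 * n - u ∧ τ.nat 4 = n ∧ τ.nat 7 = 2 * n - 1 ∧ τ.fst = σ.fst ∧ τ.mid = σ.mid ∧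
    τ.lst = σ.lst ∧ τ.rat 2 = w u ∧ Reached n r p w u σ.mid σ.fst (τ.nat 5) ∧
    τ.nat 6 = σ.mid (τ.nat 5) ∧ σ.fst (τ.nat 6) ≤ w u) ?_ ?_
  · refine Runs.loop (T := 8) (by decide) (by decide) (fun k τ => τ.nat 0 = u ∧
      τ.nat 1 = 2 * n - u ∧ τ.nat 4 = n ∧ τ.nat 7 = 2 * n - 1 ∧ τ.fst = σ.fst ∧ τ.mid = σ.mid ∧
      τ.lst = σ.lst ∧ τ.rat 2 = w u ∧ Reached n r p w u σ.mid σ.fst (τ.nat 5) ∧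
      τ.nat 6 = σ.mid (τ.nat 5) ∧ τ.rat 9 = σ.fst (τ.nat 6) ∧ rank (τ.nat 5) ≤ k)
      (fun k τ hI hc => ?_) (fun k τ hI hc => ?_) n ?_
    · obtain ⟨i0, i1, i4, i7, if', im, il, iw, ir, i6, i9, ik⟩ := hI
      simp [State.eval, IsNatReg, iw, i9, i6] at hc
      have hr' := ir.step hl hb hu hun hc
      refine Runs.copyNat (by decide) (by decide) <|
        Runs.loadMid hB (by decide) (by decide)
          (by simp [i6]; exact hr'.present.lt_two_mul hu2) <|
        Runs.loadFst hB (by decide) (by decide)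
          (by simp [i6, im]; exact hpar _ hr'.present hr'.ne_root) <|
        Runs.skip ⟨rank (σ.mid (τ.nat 5)),
          (hb.rank_lt _ ir.present ir.ne_root).trans_le ik, ?_⟩
      simp [i0, i1, i4, i7, if', im, il, iw, i6, hr']
    · obtain ⟨i0, i1, i4, i7, if', im, il, iw, ir, i6, i9, ik⟩ := hI
      simp [State.eval, IsNatReg, iw, i9] at hc
      exact ⟨i0, i1, i4, i7, if', im, il, iw, ir, i6, hc⟩
    · have hk := (hb.rank_le _ hr0.present).trans hu2
      simp [h.nat_zero, h.nat_one, h.nat_four, h.nat_seven, h.lst, hmu, hr0, hk]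
  · rintro τ ⟨i0, i1, i4, i7, if', im, il, iw, ir, i6, i9⟩
    have hx2 := ir.present.lt_two_mul hu2
    rw [i6] at i9
    refine Runs.setNat hB (2 * n - 1 - u) (by decide) (by decide) (by decide) ?_
      (by unfold cells; omega) <|
      Runs.storeFst hB (by decide) (by decide) (by simp; omega) <|
      Runs.storeMid hB (by decide) (by decide) (by simp; omega) <|
      Runs.storeMid hB (by decide) (by decide) (by simpa using hx2) <|
      Runs.storeMid hB (by decide) (by decide) (by simp; omega) <|
      Runs.setNat hB (u + 1) (by decide) (by decide) (by decide) ?_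
        (by unfold cells; omega) <| Runs.skip ?_
    · simp [State.eval, IsNatReg, BinOp.eval, i1]
      rw [Nat.cast_sub (by omega), Nat.cast_sub (by omega), Nat.cast_sub (by omega)]
      push_cast; ring
    · simp [State.eval, IsNatReg, BinOp.eval, i0]
    -- The nested updates in `Built.attach` are in the order of the stores of the program, so the
    -- two states agree after simplification.
    · have hatt := hb.attach hl hu hun ir i9
      refine ⟨by simp, ?_, by simpa using i4, by simpa using i7, by omega, by omega, ?_, ?_, ?_,
        ?_, ?_⟩
      · simp; omega
      · simpa [State.eval, IsNatReg, im, if', iw, i6, i0] using hatt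
      · intro i hi hin
        have h1 : i ≠ u := by omega
        have h2 : i ≠ 2 * n - 1 - u := by omega
        have h3 : i ≠ τ.nat 5 := by
          have := ir.present
          unfold Present at this
          omega
        simp [h1, h2, h3, i0, im]
        exact h.mid i (by omega) hin
      · exact il.trans h.lst
      · intro j
        simp [State.eval, IsNatReg, if', iw]
        rw [Function.update_apply]
        split_ifs
        · rw [← h.lst]; exact h.bits_lst u
        · exact h.bits_fst j
      · intro j
        change bitLength (τ.lst j) ≤ b
        rw [il]; exact h.bits_lst j

/-- The lengths of the edges at the nodes below `k` have been computed. -/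
structure Measuring (n : ℕ) (par : ℕ → ℕ) (h : ℕ → ℚ) (k : ℕ) (σ : State) : Prop where
  nat_zero : σ.nat 0 = k
  nat_seven : σ.nat 7 = 2 * n - 1
  le : k ≤ 2 * n - 1
  fst : σ.fst = h
  mid : σ.mid = par
  lst : ∀ i < k, σ.lst i = h i - h (par i)

/-- Lengths replace the weights, which are no longer needed, while the heights in `fst` stay intact;
only the labelling afterwards overwrites them. -/
theorem runs_lengthStep (hB : Fits n B) {par : ℕ → ℕ} {h : ℕ → ℚ} {k : ℕ}
    (hbB : 4 * b ≤ B) (hh : ∀ j, bitLength (h j) ≤ b) (hk : k < 2 * n - 1)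
    (hpar : par k < 2 * n) (hm : Measuring n par h k σ) :
    Runs n B lengthStep σ 15 (Measuring n par h (k + 1)) := by
  refine Runs.loadMid hB (by decide) (by decide) (by rw [hm.nat_zero]; omega) <|
    Runs.loadFst hB (by decide) (by decide) (by simp [hm.nat_zero]; omega) <|
    Runs.loadFst hB (by decide) (by decide) (by simp [hm.nat_zero, hm.mid, hpar]) <|
    Runs.setRat (by decide) (by decide) (by decide) ?_ <|
    Runs.storeLst hB (by decide) (by decide) (by simp [hm.nat_zero]; omega) <|
    Runs.setNat hB (k + 1) (by decide) (by decide) (by decide) ?_ (by unfold cells; omega) <|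
    Runs.skip ?_
  · simp [State.eval, IsNatReg, BinOp.eval, hm.nat_zero, hm.mid, hm.fst]
    have := bitLength_sub_le (h k) (h (par k))
    have := hh k
    have := hh (par k)
    omega
  · simp [State.eval, IsNatReg, BinOp.eval, hm.nat_zero]
  · refine ⟨by simp, by simpa using hm.nat_seven, by omega, hm.fst, hm.mid, fun i hi => ?_⟩
    simp [State.eval, IsNatReg, BinOp.eval, hm.nat_zero, hm.mid, hm.fst]
    by_cases hik : i = k
    · simp [hik]
    · simp [hik]; exact hm.lst i (by omega)

/-- The nodes below `k` have been written down. -/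
structure Labelling (n : ℕ) (par : ℕ → ℕ) (len : ℕ → ℚ) (k : ℕ) (σ : State) : Prop where
  nat_zero : σ.nat 0 = k
  nat_seven : σ.nat 7 = 2 * n - 1
  le : k ≤ 2 * n - 1
  fst : ∀ i < k, σ.fst i = i
  mid : σ.mid = par
  lst : ∀ i < 2 * n - 1, σ.lst i = len i

theorem runs_labelStep (hB : Fits n B) {par : ℕ → ℕ} {len : ℕ → ℚ} {k : ℕ}
    (hk : k < 2 * n - 1) (hm : Labelling n par len k σ) :
    Runs n B labelStep σ 5 (Labelling n par len (k + 1)) := by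
  refine Runs.storeFst hB (by decide) (by decide) (by rw [hm.nat_zero]; omega) <|
    Runs.setNat hB (k + 1) (by decide) (by decide) (by decide) ?_ (by unfold cells; omega) <|
    Runs.skip ?_
  · simp [State.eval, IsNatReg, BinOp.eval, hm.nat_zero]
  · refine ⟨by simp, by simpa using hm.nat_seven, by omega, fun i hi => ?_, hm.mid, hm.lst⟩
    simp [State.eval, IsNatReg, hm.nat_zero]
    by_cases hik : i = k
    · simp [hik]
    · simp [hik]; exact hm.fst i (by omega)

/-- The state lists the edges of the tree that has been built. -/
structure Output (n : ℕ) (r : ℕ → ℚ) (p : ℕ → ℕ) (w : ℕ → ℚ) (par : ℕ → ℕ) (h : ℕ → ℚ)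
    (rank : ℕ → ℕ) (σ : State) : Prop where
  built : Built n r p w n par h rank
  nat_zero : σ.nat 0 = 2 * n
  nat_one : σ.nat 1 = 12
  fst : ∀ i < 2 * n - 1, σ.fst i = i
  mid : σ.mid = par
  lst : ∀ i < 2 * n - 1, σ.lst i = h i - h (par i)

theorem Runs.setLit {T : ℕ} {Q : State → Prop} {c : Cmd} {i : ℕ} {q : ℚ} (hB : Fits n B) (k : ℕ)
    (hq : q = k) (hi : IsNatReg i) (hk : k ≤ cells n)
    (hc : Runs n B c { σ with nat := Function.update σ.nat i k } T Q) :
    Runs n B (.seq (TreeFit.setLit i q) c) σ (T + 1) Q :=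
  Runs.setNat hB k hi trivial trivial (by simp [State.eval, BinOp.eval, hq]) hk hc

/-- No instruction writes the height of the root; that it is zero comes from `hrn` at index `2 * n -
1`. As the root has the last number, the other nodes enumerate the edges to parents without a gap.
-/
theorem runs_buildTree (hn : 1 ≤ n) (hB : Fits n B) (hbB : 4 * b ≤ B)
    (hl : Linked n r σ.mid σ.lst) (h4 : σ.nat 4 = n) (hf : σ.fst = r) (hr0 : r 0 = 0)
    (hrn : ∀ j, n ≤ j → r j = 0) (hbr : ∀ j, bitLength (r j) ≤ b)
    (hbw : ∀ j, bitLength (σ.lst j) ≤ b) :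
    Runs n B buildTree σ (8 + ((38 + 9 * n + 1) * n + 1 + (1 + ((15 + 1) * (2 * n) + 1 +
      (1 + ((5 + 1) * (2 * n) + 1 + 3)))))) fun σ' =>
      ∃ par h rank, Output n r σ.mid σ.lst par h rank σ' := by
  rw [add_comm 8]
  refine Runs.setNat hB (2 * n) (by decide) (by decide) (by decide) ?_ (by unfold cells; omega) <|
    Runs.setNat hB (2 * n - 1) (by decide) (by decide) (by decide) ?_ (by unfold cells; omega) <|
    Runs.setLit hB 0 (by simp) (by decide) (by unfold cells; omega) <|
    Runs.storeMid hB (by decide) (by decide) (by simp; omega) <|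
    Runs.copyNat (by decide) (by decide) <|
    Runs.setLit hB 1 (by simp) (by decide) (by unfold cells; omega) ?_
  · simp [State.eval, IsNatReg, BinOp.eval, h4]; ring
  · simp [State.eval, IsNatReg, BinOp.eval]
    rw [Nat.cast_sub (by omega)]; push_cast; ring
  refine Runs.seq (R := Attaching n b r σ.mid σ.lst n) ?_ ?_
  · refine Runs.loop (by decide) (by decide)
      (fun k τ => ∃ u, Attaching n b r σ.mid σ.lst u τ ∧ n - u ≤ k)
      (fun k τ hI hc => ?_) (fun k τ hI hc => ?_) n ⟨1, ?_, by omega⟩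
    · obtain ⟨u, hI, hk⟩ := hI
      simp [State.eval, IsNatReg, hI.nat_zero, hI.nat_four] at hc
      refine (runs_attachStep hB hl hI hc).mono le_rfl fun τ' hτ' => ?_
      exact ⟨n - (u + 1), by omega, u + 1, hτ', le_rfl⟩
    · obtain ⟨u, hI, hk⟩ := hI
      simp [State.eval, IsNatReg, hI.nat_zero, hI.nat_four] at hc
      have : u = n := le_antisymm hI.le hc
      exact this ▸ hI
    · refine ⟨by simp, by simp, by simpa using h4, by simp, le_rfl, hn, ?_, ?_, rfl, ?_, hbw⟩
      · exact ⟨_, Built.init hn hr0 (by simp) (fun k _ => by simp [hf])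
          (by simp [hf]; exact hrn _ (by omega))⟩
      · intro i hi _
        have : i ≠ 0 := by omega
        simp [this]
      · intro j; dsimp only; rw [hf]; exact hbr j
  · intro τ hτ
    obtain ⟨rank, hb⟩ := hτ.built
    have hpar : ∀ k < 2 * n - 1, τ.mid k < 2 * n := fun k hk =>
      (hb.present k (by unfold Present; omega) (by omega)).lt_two_mul le_rfl
    rw [add_comm 1]
    refine Runs.setLit hB 0 (by simp) (by decide) (by unfold cells; omega) ?_
    refine Runs.seq (R := Measuring n τ.mid τ.fst (2 * n - 1)) ?_ ?_
    · refine Runs.loop (by decide) (by decide)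
        (fun k τ' => ∃ u, Measuring n τ.mid τ.fst u τ' ∧ 2 * n - u ≤ k)
        (fun k τ' hI hc => ?_) (fun k τ' hI hc => ?_) (2 * n) ⟨0, ?_, by omega⟩
      · obtain ⟨u, hI, hk⟩ := hI
        simp [State.eval, IsNatReg, hI.nat_zero, hI.nat_seven] at hc
        refine (runs_lengthStep hB hbB hτ.bits_fst hc (hpar u hc) hI).mono le_rfl
          fun τ'' hτ'' => ?_
        exact ⟨2 * n - (u + 1), by omega, u + 1, hτ'', le_rfl⟩
      · obtain ⟨u, hI, hk⟩ := hI
        simp [State.eval, IsNatReg, hI.nat_zero, hI.nat_seven] at hc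
        have hu := hI.le
        have : u = 2 * n - 1 := by omega
        exact this ▸ hI
      · exact ⟨by simp, by simpa using hτ.nat_seven, by omega, rfl, rfl, fun i hi => by omega⟩
    · intro τ₁ h₁
      rw [add_comm 1]
      refine Runs.setLit hB 0 (by simp) (by decide) (by unfold cells; omega) ?_
      refine Runs.seq (T₁ := (5 + 1) * (2 * n) + 1) (T₂ := 3)
        (R := Labelling n τ.mid (fun i => τ.fst i - τ.fst (τ.mid i)) (2 * n - 1)) ?_ ?_
      · refine Runs.loop (by decide) (by decide)
          (fun k τ' => ∃ u, Labelling n τ.mid (fun i => τ.fst i - τ.fst (τ.mid i)) u τ' ∧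
            2 * n - u ≤ k)
          (fun k τ' hI hc => ?_) (fun k τ' hI hc => ?_) (2 * n) ⟨0, ?_, by omega⟩
        · obtain ⟨u, hI, hk⟩ := hI
          simp [State.eval, IsNatReg, hI.nat_zero, hI.nat_seven] at hc
          refine (runs_labelStep hB hc hI).mono le_rfl fun τ'' hτ'' => ?_
          exact ⟨2 * n - (u + 1), by omega, u + 1, hτ'', le_rfl⟩
        · obtain ⟨u, hI, hk⟩ := hI
          simp [State.eval, IsNatReg, hI.nat_zero, hI.nat_seven] at hc
          have hu := hI.le
          have : u = 2 * n - 1 := by omega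
          exact this ▸ hI
        · exact ⟨by simp, by simpa using h₁.nat_seven, by omega, fun i hi => by omega, h₁.mid,
            h₁.lst⟩
      · intro τ₂ h₂
        refine Runs.setNat hB (2 * n) (by decide) (by decide) (by decide) ?_
          (by unfold cells; omega) <|
          Runs.setLit hB 12 (by simp) (by decide) (by unfold cells; omega) <| Runs.skip
          ⟨τ.mid, τ.fst, rank, hb, by simp, by simp, h₂.fst, h₂.mid, h₂.lst⟩
        simp [State.eval, IsNatReg, BinOp.eval, h₂.nat_seven]
        rw [Nat.cast_sub (by omega)]; push_cast; ring

end

/-! ### Passes -/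

def feedState {n : ℕ} (D : Pairs (Fin n) → ℚ) (a : Item n) (σ : State) : State :=
  { σ with
    nat := Function.update (Function.update σ.nat 0 a.1.1) 1 a.1.2
    rat := Function.update σ.rat 2 (D a.pair) }

theorem Rep.feed {n B : ℕ} (hB : Fits n B) {D : Pairs (Fin n) → ℚ}
    (hD : ∀ e, bitLength (D e) ≤ B) {σ : State} {M : Mem} (h : Rep n B σ M) (a : Item n) :
    Rep n B (feedState D a σ) (feed D a M) := by
  have h0 := a.1.1.isLt
  have h1 := a.1.2.isLt
  exact ((h.update_nat (i := 0) (by decide) (hB _ (by unfold cells; omega))).update_nat (i := 1)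
    (by decide) (hB _ (by unfold cells; omega))).update_rat (by decide) (hD _)

/-- The invariant is indexed by the entries already read, so at the end of the pass it speaks of the
whole stream. -/
theorem exists_execPass {n B T : ℕ} (hB : Fits n B) {D : Pairs (Fin n) → ℚ}
    (hD : ∀ e, bitLength (D e) ≤ B) {body : Cmd} (I : List (Item n) → State → Prop)
    (hstep : ∀ l a σ, I l σ → Runs n B body (feedState D a σ) T (I (l ++ [a])))
    (l l₀ : List (Item n)) (σ : State) (M : Mem) (hI : I l₀ σ) (hM : Rep n B σ M) :
    ∃ (M' : Mem) (t s : ℕ) (σ' : State), ExecPass D body l M M' t s ∧ t ≤ l.length * (T + 1) ∧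
      s ≤ spaceBound (cells n) B ∧ Rep n B σ' M' ∧ I (l₀ ++ l) σ' := by
  induction l generalizing l₀ σ M with
  | nil => exact ⟨M, 0, _, σ, .nil M, by simp, hM.bounded.bits_le, hM, by simpa using hI⟩
  | cons a l ih =>
    obtain ⟨M₁, t₁, s₁, σ₁, e₁, ht₁, hs₁, r₁, q₁⟩ := hstep l₀ a σ hI _ (hM.feed hB hD a)
    obtain ⟨M₂, t₂, s₂, σ₂, e₂, ht₂, hs₂, r₂, q₂⟩ := ih (l₀ ++ [a]) σ₁ M₁ q₁ r₁
    refine ⟨M₂, _, _, σ₂, .cons e₁ e₂, ?_, max_le hs₁ hs₂, r₂, by simpa using q₂⟩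
    rw [List.length_cons, add_mul]
    omega

/-- The distance of `j` from `0`. -/
def rootDist {n : ℕ} (D : Pairs (Fin n) → ℚ) (j : ℕ) : ℚ :=
  if h : 0 < j ∧ j < n then
    D (mkPair ⟨0, h.1.trans h.2⟩ ⟨j, h.2⟩ (by simp [Fin.ext_iff]; omega))
  else 0

section

variable {n b B : ℕ} {D : Pairs (Fin n) → ℚ} {σ : State}

theorem mkPair_comm {V : Type} (u v : V) (h : u ≠ v) : mkPair u v h = mkPair v u h.symm :=
  Subtype.ext Sym2.eq_swap

theorem rootDist_of_left (a : Item n) (h : (a.1.1 : ℕ) = 0) : rootDist D a.1.2 = D a.pair := by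
  obtain ⟨⟨u, v⟩, huv⟩ := a
  have hv : (v : ℕ) ≠ 0 := fun hv => huv (Fin.ext (by simp at h; simp [h, hv]))
  unfold rootDist
  rw [dif_pos ⟨Nat.pos_of_ne_zero hv, v.isLt⟩]
  refine congrArg D (Subtype.ext ?_)
  exact congrArg (fun x => s(x, v)) (show (⟨0, v.pos⟩ : Fin n) = u from Fin.ext h.symm)

theorem rootDist_of_right (a : Item n) (h : (a.1.2 : ℕ) = 0) :
    rootDist D a.1.1 = D a.pair := by
  have := rootDist_of_left (D := D) ⟨(a.1.2, a.1.1), a.2.symm⟩ h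
  rw [this]
  unfold Item.pair
  rw [mkPair_comm]

theorem rootDist_zero : rootDist D 0 = 0 := by simp [rootDist]

theorem rootDist_of_le {j : ℕ} (h : n ≤ j) : rootDist D j = 0 := by
  unfold rootDist; rw [dif_neg (by omega)]

theorem rootDist_nonneg (hD : ∀ e, 0 ≤ D e) (j : ℕ) : 0 ≤ rootDist D j := by
  unfold rootDist; split_ifs
  · exact hD _
  · exact le_rfl

theorem bitLength_rootDist_le (hb : 2 ≤ b) (hD : ∀ e, bitLength (D e) ≤ b) (j : ℕ) :
    bitLength (rootDist D j) ≤ b := by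
  unfold rootDist; split_ifs
  · exact hD _
  · exact le_trans (by decide) hb

/-- The distances from `0` in the list `l` have been recorded. -/
structure Recording (D : Pairs (Fin n) → ℚ) (l : List (Item n)) (σ : State) : Prop where
  order : σ.nat 4 = n
  mid : σ.mid = fun _ => 0
  lst : σ.lst = fun _ => 0
  fst : ∀ j, σ.fst j = rootDist D j ∨ σ.fst j = 0
  left : ∀ a ∈ l, (a.1.1 : ℕ) = 0 → σ.fst a.1.2 = rootDist D a.1.2
  right : ∀ a ∈ l, (a.1.2 : ℕ) = 0 → σ.fst a.1.1 = rootDist D a.1.1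

theorem Recording.record {l : List (Item n)} (h : Recording D l σ) (a : Item n) (i : ℕ)
    (hi : D a.pair = rootDist D i) (hl : (a.1.1 : ℕ) = 0 → i = a.1.2)
    (hr : (a.1.2 : ℕ) = 0 → i = a.1.1) :
    Recording D (l ++ [a]) { feedState D a σ with fst := Function.update σ.fst i (D a.pair) } := by
  have key : ∀ j, σ.fst j = rootDist D j →
      Function.update σ.fst i (D a.pair) j = rootDist D j := fun j hj => by
    by_cases hji : j = i
    · rw [hji, Function.update_self, hi]
    · rw [Function.update_of_ne hji, hj]
  refine ⟨by simpa [feedState] using h.order, h.mid, h.lst, fun j => ?_, fun c hc hc0 => ?_,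
    fun c hc hc0 => ?_⟩
  · by_cases hji : j = i
    · left; simp [hji, hi]
    · simpa [hji] using h.fst j
  · rw [List.mem_append, List.mem_singleton] at hc
    rcases hc with hc | rfl
    · exact key _ (h.left c hc hc0)
    · rw [← hl hc0, ← hi]; simp
  · rw [List.mem_append, List.mem_singleton] at hc
    rcases hc with hc | rfl
    · exact key _ (h.right c hc hc0)
    · rw [← hr hc0, ← hi]; simp

theorem runs_recordBody (hB : Fits n B) {l : List (Item n)} (h : Recording D l σ) (a : Item n) :
    Runs n B recordBody (feedState D a σ) 6 (Recording D (l ++ [a])) := by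
  have h1 := a.1.1.isLt
  have h2 := a.1.2.isLt
  have hne : (a.1.1 : ℕ) ≠ a.1.2 := fun he => a.2 (Fin.ext he)
  refine Runs.ite (by decide) trivial (fun hc => ?_) (fun hc => ?_)
  · simp [State.eval, IsNatReg, feedState] at hc
    refine Runs.storeFst hB (by decide) (by decide) (by simp [feedState]; omega) <| Runs.skip ?_
    have := h.record a a.1.2 (rootDist_of_left a (by simp [hc])).symm (fun _ => rfl)
      (fun h0 => by simp [hc] at hne; omega)
    simpa [State.eval, IsNatReg, feedState] using this
  · simp [State.eval, IsNatReg, feedState] at hc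
    refine Runs.ite (by decide) trivial (fun hc' => ?_) (fun hc' => ?_)
    · simp [State.eval, IsNatReg, feedState] at hc'
      refine Runs.storeFst hB (by decide) (by decide) (by simp [feedState]; omega) <| Runs.skip ?_
      have := h.record a a.1.1 (rootDist_of_right a (by simp [hc'])).symm
        (fun h0 => by simp [hc'] at hne; omega) (fun _ => rfl)
      simpa [State.eval, IsNatReg, feedState] using this
    · simp [State.eval, IsNatReg, feedState] at hc'
      refine Runs.skip ⟨by simpa [feedState] using h.order, h.mid, h.lst, h.fst,
        fun c hc hc0 => ?_, fun c hc hc0 => ?_⟩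
      · rw [List.mem_append, List.mem_singleton] at hc
        rcases hc with hc | rfl
        · exact h.left c hc hc0
        · omega
      · rw [List.mem_append, List.mem_singleton] at hc
        rcases hc with hc | rfl
        · exact h.right c hc hc0
        · omega

/-- Every pair with `0` occurs in the stream, in one of its two orientations. At the other indices
both the recorded value and the distance are zero. -/
theorem Recording.fst_eq {l : List (Item n)} (h : Recording D l σ) (hl : IsStream l) :
    σ.fst = rootDist D := by
  funext j
  by_cases hj : 0 < j ∧ j < n
  · have hne : (⟨0, hj.1.trans hj.2⟩ : Fin n) ≠ ⟨j, hj.2⟩ := by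
      simp [Fin.ext_iff]; omega
    obtain ⟨a, ha, he⟩ := List.mem_map.mp (hl.2 (mkPair _ _ hne))
    have he' : s(a.1.1, a.1.2) = s((⟨0, hj.1.trans hj.2⟩ : Fin n), ⟨j, hj.2⟩) :=
      congrArg Subtype.val he
    rw [Sym2.eq_iff] at he'
    rcases he' with ⟨e1, e2⟩ | ⟨e1, e2⟩
    · have := h.left a ha (by rw [e1])
      rwa [e2] at this
    · have := h.right a ha (by rw [e2])
      rwa [e1] at this
  · have h0 : rootDist D j = 0 := by unfold rootDist; rw [dif_neg hj]
    rcases h.fst j with h1 | h1 <;> rw [h1]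
    exact h0.symm

/-- `S` is bounded below by `0` and by the clipped Gromov products of the entries in `l`. -/
def Seen (D : Pairs (Fin n) → ℚ) (l : List (Item n)) (S : ℕ → ℕ → ℝ) : Prop :=
  (∀ u, 1 ≤ u → u < n → 0 ≤ S u 0) ∧ ∀ a ∈ l,
    ((clipped (rootDist D a.1.1) (rootDist D a.1.2) (D a.pair) : ℚ) : ℝ) ≤ S a.1.1 a.1.2

/-- The entries in `l` have been inserted into the spanning tree. -/
structure Inserted (b : ℕ) (D : Pairs (Fin n) → ℚ) (l : List (Item n)) (σ : State) : Prop where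
  order : σ.nat 4 = n
  fst : σ.fst = rootDist D
  linked : Linked n (rootDist D) σ.mid σ.lst
  iff : ∀ S : ℕ → ℕ → ℝ, IsGromov S → (∀ i < n, (rootDist D i : ℝ) ≤ S i i) →
    (Sat n σ.mid σ.lst S ↔ Seen D l S)
  bits_lst : ∀ j, bitLength (σ.lst j) ≤ b

/-- The untouched columns of zeros already encode a spanning tree: the star at `0` with all weights
zero. This is the source of the first clause of `Seen`. -/
theorem Recording.inserted {l : List (Item n)} (h : Recording D l σ) (hl : IsStream l)
    (hD : ∀ e, 0 ≤ D e) (hb : 2 ≤ b) : Inserted b D [] σ := by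
  refine ⟨h.order, h.fst_eq hl, ⟨?_, ?_, ?_, ?_⟩, fun S hS hd => ?_, fun j => ?_⟩
  · intro u hu _; rw [h.mid]; exact hu
  · intro u _ _; rw [h.lst]
  · intro u _ _; rw [h.lst]; exact rootDist_nonneg hD u
  · intro u _ _; rw [h.lst]; exact rootDist_nonneg hD _
  · simp [Sat, Seen, h.lst, h.mid]
  · have : bitLength (0 : ℚ) ≤ 2 := by decide
    rw [h.lst]; exact this.trans hb

theorem clipped_nonneg {x y d : ℚ} (hx : 0 ≤ x) (hy : 0 ≤ y) : 0 ≤ clipped x y d :=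
  le_min hy (le_min hx (le_max_left _ _))

theorem runs_insertBody (hB : Fits n B) {b₀ : ℕ} (hb₀ : 2 ≤ b₀) (hbB : 10 * b₀ + 2 ≤ B)
    (hD : ∀ e, 0 ≤ D e) (hDb : ∀ e, bitLength (D e) ≤ b₀) {l : List (Item n)}
    (h : Inserted (10 * b₀ + 2) D l σ) (a : Item n) :
    Runs n B (.seq gromovProduct insertEdge) (feedState D a σ) (18 + (5 + (24 * (2 * n) + 1)))
      (Inserted (10 * b₀ + 2) D (l ++ [a])) := by
  have h1 := a.1.1.isLt
  have h2 := a.1.2.isLt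
  refine Runs.seq (runs_gromovProduct hB hb₀ hbB (by simp [feedState]) (by simp [feedState])
    (fun j => ?_) (by simpa [feedState] using hDb _)) ?_
  · change bitLength (σ.fst j) ≤ b₀
    rw [h.fst]; exact bitLength_rootDist_le hb₀ hDb j
  rintro τ ⟨t1, t2, t3, t4, t5, t6⟩
  have t2' : τ.fst = rootDist D := t2.trans h.fst
  have e0 : τ.nat 0 = a.1.1 := by rw [t1]; simp [feedState]
  have e1 : τ.nat 1 = a.1.2 := by rw [t1]; simp [feedState]
  have t5' : τ.rat 2 = clipped (rootDist D a.1.1) (rootDist D a.1.2) (D a.pair) := by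
    rw [t5]; simp [feedState, h.fst]
  have t3' : τ.mid = σ.mid := t3
  have t4' : τ.lst = σ.lst := t4
  have hins : Inserting n (10 * b₀ + 2) (rootDist D) (Seen D (l ++ [a])) τ := by
    refine ⟨by rw [t1]; simpa [feedState] using h.order, t2', ?_,
      fun j => by rw [t4']; exact h.bits_lst j, t6⟩
    rw [e0, e1, t5', t3', t4']
    refine ⟨h.linked, h1, h2, clipped_nonneg (rootDist_nonneg hD _) (rootDist_nonneg hD _),
      (min_le_right _ _).trans (min_le_left _ _), min_le_left _ _, fun S hS hd => ?_⟩
    rw [h.iff S hS hd]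
    simp only [Seen, List.mem_append, List.mem_singleton, or_imp, forall_and, forall_eq, and_assoc]
  refine (runs_insertEdge hB hins).mono le_rfl ?_
  rintro τ' ⟨i1, i2, i3, i4, i5⟩
  exact ⟨i1, i2, i3, i4, i5⟩

end

/-! ### The tree in memory -/

/-- `S` consists of the ancestor heights in the output tree. `Built.lower` applied to `S` itself
gives the constraints, and `Built.upper` with the minimality of `meet` gives that `S` is least. -/
theorem Output.exists_tree {n B : ℕ} {r : ℕ → ℚ} {p : ℕ → ℕ} {w : ℕ → ℚ} {par : ℕ → ℕ}
    {h : ℕ → ℚ} {rank : ℕ → ℕ} {σ : State} {M : Mem} (hn : 1 ≤ n)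
    (ho : Output n r p w par h rank σ) (hM : Rep n B σ M) :
    ∃ (T : WeightedTree (Fin n)) (d : Pairs (Fin n) → ℝ) (S : ℕ → ℕ → ℝ), Holds M T ∧
      T.Induces d ∧ IsGromov S ∧ (∀ i < n, S i i = r i) ∧ Sat n p w S ∧
      (∀ S' : ℕ → ℕ → ℝ, IsGromov S' → (∀ i < n, (r i : ℝ) ≤ S' i i) → Sat n p w S' →
        ∀ i < n, ∀ j < n, S i j ≤ S' i j) ∧
      ∀ u v (huv : u ≠ v), d (mkPair u v huv) = r u + r v - 2 * S u v := by
  have hb := ho.built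
  have hpres : ∀ k < 2 * n, Present n n k := fun k hk => by unfold Present; omega
  let root : Fin (2 * n) := ⟨2 * n - 1, by omega⟩
  have hroot : ∀ x : Fin (2 * n), x ≠ root → (x : ℕ) ≠ 2 * n - 1 := fun x hx he =>
    hx (Fin.ext he)
  -- The value beyond the range is immaterial; any total map pulls the Gromov law back to `ℕ`.
  let ι : ℕ → Fin (2 * n) := fun i => if hi : i < 2 * n then ⟨i, hi⟩ else root
  have hι : ∀ i (hi : i < 2 * n), ι i = ⟨i, hi⟩ := fun i hi => dif_pos hi
  have hιv : ∀ i, i < 2 * n → (ι i : ℕ) = i := fun i hi => by rw [hι i hi]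
  let parF : Fin (2 * n) → Fin (2 * n) := fun x => ι (par x)
  let rankF : Fin (2 * n) → ℕ := fun x => rank x
  let hF : Fin (2 * n) → ℝ := fun x => h x
  have hlt : ∀ x : Fin (2 * n), x ≠ root → par x < 2 * n := fun x hx =>
    (hb.present x (hpres x x.isLt) (hroot x hx)).lt_two_mul le_rfl
  have hval : ∀ x : Fin (2 * n), x ≠ root → (parF x : ℕ) = par x := fun x hx =>
    hιv _ (hlt x hx)
  have hr : Ranked root parF rankF := fun x hx => by
    change rank (parF x) < rank x
    rw [hval x hx]; exact hb.rank_lt x (hpres x x.isLt) (hroot x hx)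
  have hm : ∀ x, x ≠ root → hF (parF x) ≤ hF x := fun x hx => by
    change (h (parF x) : ℝ) ≤ h x
    rw [hval x hx]; exact_mod_cast hb.mono x (hpres x x.isLt) (hroot x hx)
  have hgr := hr.isGromov_meet hm
  let T : WeightedTree (Fin n) :=
    { order := 2 * n
      graph := parentGraph root parF
      isTree := hr.isTree_parentGraph
      weight := Sym2.lift ⟨fun x y => |hF x - hF y|, fun x y => abs_sub_comm _ _⟩
      weight_nonneg := fun e => by
        induction e using Sym2.ind with
        | _ x y => exact abs_nonneg _
      node := Fin.castLEEmb (by omega) }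
  let S : ℕ → ℕ → ℝ := fun i j => meet parF rankF hF (ι i) (ι j)
  have hS : IsGromov S := hgr.comp ι
  have hdiag : ∀ i < n, S i i = r i := fun i hi => by
    change meet parF rankF hF (ι i) (ι i) = _
    rw [meet_self]
    change (h (ι i) : ℝ) = _
    rw [hιv i (by omega), hb.leaf i hi]
  refine ⟨T, fun e => Sym2.lift ⟨fun u v : Fin n => (r u + r v - 2 * S u v : ℝ),
    fun u v => by beta_reduce; rw [hS.symm]; ring⟩ e.1, S, ?_, ?_, hS, hdiag, ?_, ?_, fun u v huv => rfl⟩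
  · have cell : ∀ k < 2 * n - 1, M (12 + 3 * k) = k ∧ M (12 + 3 * k + 1) = par k ∧
        M (12 + 3 * k + 2) = h k - h (par k) := fun k hk =>
      ⟨by rw [hM.fst, ho.fst k hk], by rw [hM.mid, ho.mid], by rw [hM.lst, ho.lst k hk]⟩
    refine ⟨?_, fun v => rfl, 12, ?_, fun x y => ?_, fun x y k hk hx hy => ?_⟩
    · rw [hM.nat 0 (by decide), ho.nat_zero]
    · rw [hM.nat 1 (by decide), ho.nat_one]
    · change (parentGraph root parF).Adj x y ↔ ∃ k < 2 * n - 1, _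
      rw [hr.parentGraph_adj]
      constructor
      · rintro (⟨hx, he⟩ | ⟨hx, he⟩)
        · have hk := hroot x hx
          have hx2 : (x : ℕ) < 2 * n := x.isLt
          obtain ⟨c1, c2, -⟩ := cell x (by omega)
          exact ⟨x, by omega, .inl ⟨c1, by rw [c2, ← he, hval x hx]⟩⟩
        · have hk := hroot y hx
          have hy2 : (y : ℕ) < 2 * n := y.isLt
          obtain ⟨c1, c2, -⟩ := cell y (by omega)
          exact ⟨y, by omega, .inr ⟨c1, by rw [c2, ← he, hval y hx]⟩⟩
      · rintro ⟨k, hk, hxy⟩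
        obtain ⟨c1, c2, -⟩ := cell k hk
        have main : ∀ x y : Fin (2 * n), M (12 + 3 * k) = ((x : ℕ) : ℚ) →
            M (12 + 3 * k + 1) = ((y : ℕ) : ℚ) → x ≠ root ∧ parF x = y := by
          intro x y h1 h2
          rw [c1] at h1
          rw [c2] at h2
          have h1' : k = x := by exact_mod_cast h1
          have h2' : par k = y := by exact_mod_cast h2
          have hx : x ≠ root := by
            intro he
            rw [he] at h1'
            change k = 2 * n - 1 at h1'
            omega
          exact ⟨hx, Fin.ext (by rw [hval x hx, ← h1', h2'])⟩
        rcases hxy with hxy | hxy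
        · exact .inl (main x y hxy.1 hxy.2)
        · exact .inr (main y x hxy.1 hxy.2)
    · change k < 2 * n - 1 at hk
      obtain ⟨c1, c2, c3⟩ := cell k hk
      rw [c1] at hx
      rw [c2] at hy
      have hx' : k = x := by exact_mod_cast hx
      have hy' : par k = y := by exact_mod_cast hy
      rw [c3]
      change |(h x : ℝ) - h y| = _
      rw [← hx', ← hy']
      have := hb.mono k (hpres k (by omega)) (by omega)
      have : (h (par k) : ℝ) ≤ h k := by exact_mod_cast this
      rw [abs_of_nonneg (by linarith)]
      push_cast; ring
  · intro u v huv q hq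
    obtain ⟨q', hq', -, hw⟩ := hr.exists_path (G := T.graph) (h := hF) (wt := T.weight)
      (fun x hx => hr.parentGraph_adj.mpr (.inl ⟨hx, rfl⟩))
      (fun x hx => abs_of_nonneg (by linarith [hm x hx])) (T.node u) (T.node v)
    have := T.isTree.isAcyclic.subsingleton_path (T.node u) (T.node v)
    have he : q = q' := congrArg Subtype.val (this.elim ⟨q, hq⟩ ⟨q', hq'⟩)
    rw [he, hw]
    have hu : ι u = T.node u := hι u (by omega)
    have hv : ι v = T.node v := hι v (by omega)
    change (r u + r v - 2 * meet parF rankF hF (ι u) (ι v) : ℝ) = _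
    rw [hu, hv]
    change _ = (h (u : ℕ) : ℝ) + h (v : ℕ) - _
    rw [hb.leaf u u.isLt, hb.leaf v v.isLt]
  · intro i hi hin
    refine hb.lower S hS (fun k hk hkr => ?_) i hi hin
    have hk2 := hk.lt_two_mul le_rfl
    have hx : ι k ≠ root := fun he => hkr (by rw [← hιv k hk2, he])
    have hp : ι (par k) = parF (ι k) := by
      change _ = ι (par (ι k))
      rw [hιv k hk2]
    change _ ≤ meet parF rankF hF (ι k) (ι (par k))
    rw [hp, hr.meet_par hx]
    change _ ≤ (h (parF (ι k)) : ℝ)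
    rw [hval _ hx, hιv k hk2]
  · intro S' hS' hd hs i hi j hj
    obtain ⟨h1, h2⟩ := hb.upper S' hS' hd hs
    have := hr.meet_le_of_isGromov hm (hS'.comp fun x : Fin (2 * n) => owner n x)
      (fun x => h2 x (hpres x x.isLt)) (fun x hx => by
        have := h1 x (hpres x x.isLt) (hroot x hx)
        rw [← hval x hx] at this
        exact this) (ι i) (ι j)
    refine this.trans_eq ?_
    have oi : owner n (ι i) = i := by rw [hιv i (by omega)]; exact if_pos hi
    have oj : owner n (ι j) = j := by rw [hιv j (by omega)]; exact if_pos hj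
    rw [oi, oj]

/-! ### The approximation ratio -/

/-- A tree metric that comes from the least function with the Gromov law above the clipped Gromov
products is a 6-approximation. -/
theorem norm_sub_le_of_gromov {n : ℕ} (hn : 1 ≤ n) {D : Pairs (Fin n) → ℚ}
    {l : List (Item n)} (hl : IsStream l) {d : Pairs (Fin n) → ℝ} {S : ℕ → ℕ → ℝ}
    (hS : IsGromov S) (hseen : Seen D l S)
    (hmin : ∀ S' : ℕ → ℕ → ℝ, IsGromov S' → (∀ i < n, (rootDist D i : ℝ) ≤ S' i i) →
      Seen D l S' → ∀ i < n, ∀ j < n, S i j ≤ S' i j)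
    (hd : ∀ u v (huv : u ≠ v),
      d (mkPair u v huv) = rootDist D u + rootDist D v - 2 * S u v)
    {d' : Pairs (Fin n) → ℝ} (hd' : IsTreeMetric d') :
    ‖d - fun e => (D e : ℝ)‖ ≤ 6 * ‖d' - fun e => (D e : ℝ)‖ := by
  obtain ⟨T, hT⟩ := hd'
  set ε := ‖d' - fun e => (D e : ℝ)‖ with hε
  have hε0 : 0 ≤ ε := norm_nonneg _
  have hdist : ∀ e, |d' e - D e| ≤ ε := fun e => by
    have := norm_le_pi_norm (d' - fun e => (D e : ℝ)) e
    rwa [Real.norm_eq_abs] at this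
  let a : Fin n := ⟨0, by omega⟩
  obtain ⟨G, hG, hG0, hGle, hGa, hGd⟩ := T.exists_gromov a
  replace hGd := hGd d' hT
  have hroot : ∀ v : Fin n, |G v v - rootDist D v| ≤ ε := by
    intro v
    by_cases hv : v = a
    · rw [hv, hGa]
      change |0 - ((rootDist D 0 : ℚ) : ℝ)| ≤ ε
      rw [rootDist_zero]; simpa using hε0
    · have h1 := hGd a v (Ne.symm hv)
      have h2 := hGle a v
      have h3 := hG0 a v
      have h4 := hdist (mkPair a v (Ne.symm hv))
      have h5 : rootDist D v = D (mkPair a v (Ne.symm hv)) :=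
        rootDist_of_left (D := D) ⟨(a, v), Ne.symm hv⟩ rfl
      have h6 : d' (mkPair a v (Ne.symm hv)) = G v v := by rw [h1]; linarith
      rw [h5, ← h6]; exact h4
  let κ : ℕ → Fin n := fun i => if hi : i < n then ⟨i, hi⟩ else a
  have hκ : ∀ v : Fin n, κ v = v := fun v => dif_pos v.isLt
  have hκ' : ∀ i (hi : i < n), κ i = ⟨i, hi⟩ := fun i hi => dif_pos hi
  -- Each Gromov product is half of a combination of three distances, each within `ε` of its
  -- counterpart in the competing tree; hence the constant 3/2.
  have hle : ∀ u v : Fin n, S u v ≤ G u v + 3 / 2 * ε := by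
    intro u v
    have := hmin (fun i j => G (κ i) (κ j) + 3 / 2 * ε) ((hG.comp κ).add_const _)
      (fun i hi => ?_) ⟨fun i _ _ => ?_, fun c hc => ?_⟩ u u.isLt v v.isLt
    · simpa only [hκ] using this
    · have := (abs_le.mp (hroot ⟨i, hi⟩)).1
      rw [hκ' i hi]
      dsimp only at this
      linarith
    · have := hG0 (κ i) (κ 0)
      linarith
    · beta_reduce
      rw [hκ, hκ]
      have h1 := abs_le.mp (hroot c.1.1)
      have h2 := abs_le.mp (hroot c.1.2)
      have h3 := abs_le.mp (hdist c.pair)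
      have h4 : d' c.pair = _ := hGd c.1.1 c.1.2 c.2
      have h5 := hG0 c.1.1 c.1.2
      have h6 : clipped (rootDist D c.1.1) (rootDist D c.1.2) (D c.pair) ≤
          max 0 ((rootDist D c.1.1 + rootDist D c.1.2 - D c.pair) / 2) :=
        (min_le_right _ _).trans (min_le_right _ _)
      refine le_trans (Rat.cast_le.mpr h6) ?_
      push_cast
      refine max_le (by linarith) ?_
      rw [h4] at h3
      linarith [h1.1, h2.1, h3.2]
  have hge : ∀ (u v : Fin n) (huv : u ≠ v),
      ((clipped (rootDist D u) (rootDist D v) (D (mkPair u v huv)) : ℚ) : ℝ) ≤ S u v := by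
    intro u v huv
    obtain ⟨c, hc, he⟩ := List.mem_map.mp (hl.2 (mkPair u v huv))
    have h1 := hseen.2 c hc
    have he' : s(c.1.1, c.1.2) = s(u, v) := congrArg Subtype.val he
    rw [← he]
    rw [Sym2.eq_iff] at he'
    rcases he' with ⟨e1, e2⟩ | ⟨e1, e2⟩
    · rwa [e1, e2] at h1
    · rw [e1, e2, hS.symm] at h1
      have : ∀ x y z : ℚ, clipped x y z = clipped y x z := fun x y z => by
        unfold clipped
        rw [min_left_comm, add_comm]
      rwa [this]
  rw [pi_norm_le_iff_of_nonneg (by linarith)]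
  rintro ⟨e, he⟩
  induction e using Sym2.ind with
  | _ u v =>
    have huv : u ≠ v := fun h => he (Sym2.mk_isDiag_iff.mpr h)
    change ‖d (mkPair u v huv) - D (mkPair u v huv)‖ ≤ _
    rw [Real.norm_eq_abs, hd u v huv]
    have h1 := abs_le.mp (hroot u)
    have h2 := abs_le.mp (hroot v)
    have h3 := abs_le.mp (hdist (mkPair u v huv))
    rw [hGd u v huv] at h3
    have h4 := hle u v
    have h5 := hge u v huv
    have h6 := hGle u v
    have h7 := hGle v u
    rw [hG.symm] at h7
    have h8 : min (rootDist D v) (min (rootDist D u)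
        ((rootDist D u + rootDist D v - D (mkPair u v huv)) / 2)) ≤
        clipped (rootDist D u) (rootDist D v) (D (mkPair u v huv)) :=
      min_le_min_left _ (min_le_min_left _ (le_max_right _ _))
    have h9 : ((min (rootDist D v) (min (rootDist D u)
        ((rootDist D u + rootDist D v - D (mkPair u v huv)) / 2)) : ℚ) : ℝ) ≤ S u v :=
      (Rat.cast_le.mpr h8).trans h5
    push_cast at h9
    rw [abs_le]
    -- The six comes from this side: `3 * ε` from `h4`, `2 * ε` from the two distances to `0`, and
    -- `ε` from the entry itself.
    refine ⟨by linarith [h1.1, h1.2, h2.1, h2.2, h3.1, h3.2], ?_⟩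
    -- If the product was cut to a distance from `0`, then `h6` and `h7` act as the triangle
    -- inequality through `0`; if it was not cut from above, the error on this side is at most zero.
    rcases min_le_iff.mp h9 with h9 | h9
    · linarith [h1.1, h1.2, h2.1, h2.2, h3.1, h3.2]
    · rcases min_le_iff.mp h9 with h9 | h9
      · linarith [h1.1, h1.2, h2.1, h2.2, h3.1, h3.2]
      · linarith

/-! ### The resources of the algorithm -/

theorem fits_of_le {n B : ℕ} (h : Nat.size (cells n) + 2 ≤ B) : Fits n B := fun k hk => by
  rw [bitLength_natCast]
  have := Nat.size_le_size hk
  omega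

theorem IsStream.length_le {n : ℕ} {l : List (Item n)} (hl : IsStream l) : l.length ≤ n ^ 2 := by
  have h1 : l.Nodup := List.Nodup.of_map _ hl.1
  have h2 : (l.map Subtype.val).Nodup := h1.map Subtype.val_injective
  have := h2.length_le_card
  simpa [sq] using this

theorem time_le {n m : ℕ} (hn : 1 ≤ n) (hm : m ≤ n ^ 2) :
    2 + (m * (6 + 1) + 1 + (m * (18 + (5 + (24 * (2 * n) + 1)) + 1) +
      (8 + ((38 + 9 * n + 1) * n + 1 + (1 + ((15 + 1) * (2 * n) + 1 +
      (1 + ((5 + 1) * (2 * n) + 1 + 3)))))) + 0)) ≤ 300 * n ^ 3 := by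
  have h1 : m * n ≤ n ^ 3 := by
    calc m * n ≤ n ^ 2 * n := Nat.mul_le_mul_right _ hm
      _ = n ^ 3 := by ring
  have h2 : n ^ 2 ≤ n ^ 3 := Nat.pow_le_pow_right hn (by norm_num)
  have h3 : n ≤ n ^ 3 := Nat.le_self_pow (by norm_num) n
  have h4 : n * n = n ^ 2 := by ring
  have e : m * (18 + (5 + (24 * (2 * n) + 1)) + 1) = 25 * m + 48 * (m * n) := by ring
  have e' : (38 + 9 * n + 1) * n = 39 * n + 9 * n ^ 2 := by ring
  rw [e, e']
  omega

/-- There are linearly many cells, and both addresses and contents have a length linear in that of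
`n`; additive constants are absorbed because `n` has at least one digit. -/
theorem space_le (c n : ℕ) (hn : 1 ≤ n) :
    spaceBound (cells n) (40 * (c * Nat.size n + 2) + 8 + (Nat.size (cells n) + 2)) ≤
      (18 * (40 * c + 102)) * n * Nat.size n := by
  have h1 : cells n ≤ 18 * n := by unfold cells; omega
  have hs : 1 ≤ Nat.size n := Nat.size_pos.mpr hn
  have h2 : Nat.size (cells n) ≤ 6 * Nat.size n := by
    have h3 := (Nat.size_le_size h1).trans (size_mul_le 18 n)
    have : Nat.size 18 = 5 := by decide
    omega
  calc spaceBound (cells n) (40 * (c * Nat.size n + 2) + 8 + (Nat.size (cells n) + 2))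
      ≤ (18 * n) * ((40 * c + 102) * Nat.size n) := by
        refine Nat.mul_le_mul h1 ?_
        have : (40 * c + 102) * Nat.size n = 40 * (c * Nat.size n) + 102 * Nat.size n := by ring
        omega
    _ = (18 * (40 * c + 102)) * n * Nat.size n := by ring

/-- The initial state. -/
def initialState (n : ℕ) : State where
  nat := fun i => if i = 0 then n else 0
  rat := fun _ => 0
  fst := fun _ => 0
  mid := fun _ => 0
  lst := fun _ => 0

theorem rep_initialState {n B : ℕ} (hB : Fits n B) :
    Rep n B (initialState n) (Finsupp.single 0 (n : ℚ)) := by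
  have h0 : bitLength (0 : ℚ) ≤ B := by simpa using hB 0 (by omega)
  have hne : ∀ i, i ≠ 0 → (Finsupp.single 0 (n : ℚ) : Mem) i = 0 := fun i hi =>
    Finsupp.single_eq_of_ne hi
  refine ⟨fun i _ => ?_, fun i hi => ?_, fun j => ?_, fun j => ?_, fun j => ?_,
    fun i hi => ?_, fun i => ?_⟩
  · by_cases hi : i = 0
    · simp [initialState, hi]
    · simp [initialState, hi, hne i hi]
  · exact hne i (by unfold IsRatReg at hi; omega)
  · exact hne _ (by omega)
  · rw [hne _ (by omega)]; simp [initialState]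
  · exact hne _ (by omega)
  · exact hne i (by unfold cells at hi; omega)
  · by_cases hi : i = 0
    · subst hi
      simpa using hB n (by unfold cells; omega)
    · rw [hne i hi]; exact h0

theorem treeAlg_run {n : ℕ} (hn : 1 ≤ n) {D : Pairs (Fin n) → ℚ} (hD : ∀ e, 0 ≤ D e) {b B : ℕ}
    (hb : 2 ≤ b) (hDb : ∀ e, bitLength (D e) ≤ b) (hbB : 40 * b + 8 ≤ B) (hB : Fits n B)
    {l : List (Item n)} (hl : IsStream l) :
    ∃ (M : Mem) (t s : ℕ), treeAlg.Run D l M t s ∧ t ≤ 300 * n ^ 3 ∧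
      s ≤ spaceBound (cells n) B ∧
      ∃ (T : WeightedTree (Fin n)) (d : Pairs (Fin n) → ℝ), Holds M T ∧ T.Induces d ∧
        ∀ d' : Pairs (Fin n) → ℝ, IsTreeMetric d' →
          ‖d - (fun e => (D e : ℝ))‖ ≤ 6 * ‖d' - (fun e => (D e : ℝ))‖ := by
  have hDB : ∀ e, bitLength (D e) ≤ B := fun e => (hDb e).trans (by omega)
  have hinit : Runs n B treeAlg.init (initialState n) 2 (Recording D []) := by
    refine Runs.copyNat (by decide) (by decide) <| Runs.skip ?_
    exact ⟨by simp [initialState], rfl, rfl, fun _ => .inr rfl, by simp, by simp⟩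
  obtain ⟨M₀, t₀, s₀, σ₀, e₀, ht₀, hs₀, r₀, q₀⟩ := hinit _ (rep_initialState hB)
  obtain ⟨M₁, t₁, s₁, σ₁, e₁, ht₁, hs₁, r₁, q₁⟩ := exists_execPass hB hDB (Recording D)
    (fun l a σ h => runs_recordBody hB h a) l [] σ₀ M₀ q₀ r₀
  obtain ⟨M₂, t₂, s₂, σ₂, e₂, ht₂, hs₂, r₂, q₂⟩ := exists_execPass hB hDB
    (Inserted (10 * b + 2) D) (fun l a σ h => runs_insertBody hB hb (by omega) hD hDb h a) l []
    σ₁ M₁ (q₁.inserted hl hD (by omega)) r₁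
  rw [List.nil_append] at q₂
  obtain ⟨M₃, t₃, s₃, σ₃, e₃, ht₃, hs₃, r₃, par, h, rank, ho⟩ :=
    runs_buildTree (b := 10 * b + 2) hn hB (by omega) q₂.linked q₂.order q₂.fst rootDist_zero
      (fun j hj => rootDist_of_le hj)
      (fun j => (bitLength_rootDist_le hb hDb j).trans (by omega)) q₂.bits_lst M₂ r₂
  obtain ⟨T, d, S, hT, hTd, hS, hdiag, hsat, hmin, hdS⟩ := ho.exists_tree hn r₃
  have hrun : treeAlg.Run D l M₃ (t₀ + (t₁ + 1 + (t₂ + t₃ + 0)))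
      (max s₀ (max s₁ (max M₁.bits (max s₂ (max s₃ M₃.bits))))) :=
    ⟨M₀, t₀, s₀, _, _, e₀, .cons e₁ (.skip M₁) (.cons e₂ e₃ (.nil M₃)), rfl, rfl⟩
  refine ⟨M₃, _, _, hrun, ?_, ?_, T, d, hT, hTd, fun d' hd' => ?_⟩
  · refine le_trans ?_ (time_le hn hl.length_le)
    omega
  · exact max_le hs₀ (max_le hs₁ (max_le r₁.bounded.bits_le
      (max_le hs₂ (max_le hs₃ r₃.bounded.bits_le))))
  · exact norm_sub_le_of_gromov hn hl hS
      ((q₂.iff S hS fun i hi => (hdiag i hi).ge).mp hsat)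
      (fun S' hS' hd hseen => hmin S' hS' hd ((q₂.iff S' hS' hd).mpr hseen)) hdS hd'

end TreeFit

/-- There is a two-pass streaming algorithm that, whenever the distances fit in `O(log n)` bits,
runs in polynomial time and `Õ(n)` bits of memory and outputs a tree whose metric is a
6-approximation to `ℓ_∞` Best-Fit Tree-Metrics. (`Nat.size n` is the number of binary digits
of `n`.) -/
theorem mainTheorem8 :
    ∃ A : TreeFit.StreamAlg, A.passes.length = 2 ∧
      ∀ c : ℕ, ∃ K : ℕ, ∀ n : ℕ, 1 ≤ n →
        ∀ D : TreeFit.Pairs (Fin n) → ℚ,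
          (∀ e, 0 ≤ D e) → (∀ e, TreeFit.bitLength (D e) ≤ c * Nat.size n) →
        ∀ l : List (TreeFit.Item n), TreeFit.IsStream l →
          ∃ (M : TreeFit.Mem) (t s : ℕ), A.Run D l M t s ∧
            t ≤ K * n ^ K ∧
            s ≤ K * n * Nat.size n ^ K ∧
            ∃ (T : TreeFit.WeightedTree (Fin n)) (d : TreeFit.Pairs (Fin n) → ℝ),
              TreeFit.Holds M T ∧ T.Induces d ∧
              ∀ d' : TreeFit.Pairs (Fin n) → ℝ, TreeFit.IsTreeMetric d' →
                ‖d - (fun e => (D e : ℝ))‖ ≤ 6 * ‖d' - (fun e => (D e : ℝ))‖ := by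
  refine ⟨TreeFit.treeAlg, rfl, fun c => ⟨18 * (40 * c + 102), fun n hn D hD hDb l hl => ?_⟩⟩
  -- The summand 2 in `b` accommodates the number zero. `B` adds the room for edge lengths, `4 * (10
  -- * b + 2)`, to that for indices and addresses.
  obtain ⟨M, t, s, hrun, ht, hs, hT⟩ := TreeFit.treeAlg_run hn hD (b := c * Nat.size n + 2)
    (B := 40 * (c * Nat.size n + 2) + 8 + (Nat.size (TreeFit.cells n) + 2)) (by omega)
    (fun e => (hDb e).trans (by omega)) (by omega) (TreeFit.fits_of_le (by omega)) hl
  refine ⟨M, t, s, hrun, ht.trans ?_, (hs.trans (TreeFit.space_le c n hn)).trans ?_, hT⟩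
  -- The constant from the space bound exceeds both 300 and 3, so it also serves as factor and
  -- exponent for the time.
  · exact Nat.mul_le_mul (by omega) (Nat.pow_le_pow_right hn (by omega))
  · exact Nat.mul_le_mul_left _ (Nat.le_self_pow (by omega) _)
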